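/- Let $X_\bullet$ be a $2$-Segal simplicial set, i.e. for every $n\ge 2$ and every triangulation $\mathcal T$ of the convex polygon with vertices $0,\dots,n$, the induced map $X_n\to X_2\times_{X_1}\cdots\times_{X_1}X_2$ is a bijection. Consider the pseudomonoid in the monoidal bicategory $\mathrm{Span}$ of spans of sets that it determines: the underlying object is $X_1$, the multiplication $\mu$ is the span $X_1\times X_1\xleftarrow{(d_2,d_0)}X_2\xrightarrow{d_1}X_1$, the unit is $\{\bullet\}\leftarrow X_0\xrightarrow{s_0}X_1$, the associator is the composite of the inverse of $(d_3,d_1)\colon X_3\to X_2\times_{X_1}X_2$ with $(d_2,d_0)\colon X_3\to X_2\times_{X_1}X_2$, and the unitors are the inverses of the bijections $(d_1,s_0)\colon X_1\to X_0\times_{X_1}X_2$ and $(s_1,d_0)\colon X_1\to X_2\times_{X_1}X_0$. A paracyclic structure on $X_\bullet$ is a family of bijections $\tau^n\colon X_n\to X_n$, $n\ge 0$, such that $d_i\tau^n=\tau^{n-1}d_{i+1}$ for $i<n$ and $d_n\tau^n=d_0$ (for $n\ge 1$), and $s_i\tau^n=\tau^{n+1}s_{i+1}$ for $i<n$ and $s_n\tau^n=(\tau^{n+1})^2s_0$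 (for $n\ge 0$). A Frobenius structure on the pseudomonoid is a span $\varepsilon\colon X_1\to\{\bullet\}$ (the counit) such that the pairing $\alpha=\varepsilon\circ\mu$ is biexact: there are a copairing $\beta\colon\{\bullet\}\to X_1\times X_1$ and invertible $2$-morphisms $z\colon(\mathrm{id}\times\alpha)\circ(\beta\times\mathrm{id})\Rightarrow\mathrm{id}$ and $n\colon(\alpha\times\mathrm{id})\circ(\mathrm{id}\times\beta)\Rightarrow\mathrm{id}$ such that applying $z$ or $n$ gives the same $2$-morphism $(\alpha\times\alpha)\circ(\mathrm{id}\times\beta\times\mathrm{id})\Rightarrow\alpha$, and the same $2$-morphism $(\mathrm{id}\times\alpha\times\mathrm{id})\circ(\beta\times\beta)\Rightarrow\beta$. Two Frobenius structures are equivalent if their counits are $2$-isomorphic. Then for every paracyclic structure $(\tau^n)_n$ on $X_\bullet$ the span $X_1\xleftarrow{\tau^1s_0}X_0\to\{\bullet\}$ is the counit of a Frobenius structure, and sending $(\tau^n)_n$ to the equivalence class of this Frobenius structure is a bijection from the set of paracyclic structures on $X_\bullet$ to the equivalence classes of Frobenius structures on the pseudomonoid. Moreover, $(\tau^n)_n\mapsto(\tau^{n+1}s_0\colon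 X_n\to X_{n+1})_n$ is a bijection from the paracyclic structures on $X_\bullet$ to the systems of extra degeneracy maps, i.e. families $s^n_{n+1}\colon X_n\to X_{n+1}$, $n\ge 0$, with $d_is^n_{n+1}=s^{n-1}_nd_i$ for $0<i<n+1$, $d_{n+1}s^n_{n+1}=\mathrm{id}$, $s_is^n_{n+1}=s^{n+1}_{n+2}s_i$ for $0\le i\le n$, $s_{n+1}s^n_{n+1}=s^{n+1}_{n+2}s^n_{n+1}$ (where $s_{n+1}$ on the left is the last ordinary degeneracy of $X_{n+1}$), and $d_0s^n_{n+1}$ bijective for all $n$; its inverse is given by $\tau^n=d_0s^n_{n+1}$. -/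

import Mathlib

open CategoryTheory Simplicial Opposite

universe u

/-! ## Spans of sets -/

/-- A span of sets `A ← apex → B`, a `1`-morphism from `A` to `B` in the bicategory of spans. -/
structure SetSpan (A B : Type u) : Type (u + 1) where
  /-- the apex -/
  apex : Type u
  /-- the leg to the source -/
  left : apex → A
  /-- the leg to the target -/
  right : apex → B

namespace SetSpan

/-- A `2`-morphism of spans: a map of apexes commuting with both legs. -/
@[ext]
structure Hom {A B : Type u} (S T : SetSpan A B) : Type u where
  /-- the map of apexes -/
  toFun : S.apex → T.apex
  left_toFun : ∀ s, T.left (toFun s) = S.left s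
  right_toFun : ∀ s, T.right (toFun s) = S.right s

/-- An invertible `2`-morphism of spans. -/
structure Iso {A B : Type u} (S T : SetSpan A B) : Type u where
  /-- the bijection of apexes -/
  toEquiv : S.apex ≃ T.apex
  left_toEquiv : ∀ s, T.left (toEquiv s) = S.left s
  right_toEquiv : ∀ s, T.right (toEquiv s) = S.right s

namespace Iso

/-- The identity `2`-isomorphism. -/
def refl {A B : Type u} (S : SetSpan A B) : Iso S S :=
  ⟨Equiv.refl _, fun _ => rfl, fun _ => rfl⟩

/-- The inverse of a `2`-isomorphism. -/
def symm {A B : Type u} {S T : SetSpan A B} (f : Iso S T) : Iso T S where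
  toEquiv := f.toEquiv.symm
  left_toEquiv t := by
    rw [← f.left_toEquiv, Equiv.apply_symm_apply]
  right_toEquiv t := by
    rw [← f.right_toEquiv, Equiv.apply_symm_apply]

/-- The vertical composite of `2`-isomorphisms. -/
def trans {A B : Type u} {S T U : SetSpan A B} (f : Iso S T) (g : Iso T U) : Iso S U where
  toEquiv := f.toEquiv.trans g.toEquiv
  left_toEquiv s := (g.left_toEquiv _).trans (f.left_toEquiv s)
  right_toEquiv s := (g.right_toEquiv _).trans (f.right_toEquiv s)

end Iso

/-- The identity span. -/
def id (A : Type u) : SetSpan A A := ⟨A, fun a => a, fun a => a⟩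

/-- The composite `T ∘ S` of spans (in diagrammatic order), with apex the fibre product. -/
def comp {A B C : Type u} (S : SetSpan A B) (T : SetSpan B C) : SetSpan A C where
  apex := {p : S.apex × T.apex // S.right p.1 = T.left p.2}
  left p := S.left p.1.1
  right p := T.right p.1.2

/-- The monoidal product of spans, induced by the Cartesian product of sets. -/
def prod {A B A' B' : Type u} (S : SetSpan A B) (T : SetSpan A' B') :
    SetSpan (A × A') (B × B') where
  apex := S.apex × T.apex
  left p := (S.left p.1, T.left p.2)
  right p := (S.right p.1, T.right p.2)

/-- Transport of a span along bijections of its source and target. It is used to insert the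
rebracketing bijections `(A × B) × C ≃ A × (B × C)` and the bijections
`PUnit × A ≃ A ≃ A × PUnit`, which are the associators and unitors of the monoidal structure. -/
def relabel {A B A' B' : Type u} (S : SetSpan A B) (e : A ≃ A') (f : B ≃ B') :
    SetSpan A' B' where
  apex := S.apex
  left s := e (S.left s)
  right s := f (S.right s)

end SetSpan

/-! ## Pseudomonoids in spans -/

namespace SetSpan

/-- The span `μ ∘ (μ ⊗ id)`. -/
def mulLeft {X : Type u} (μ : SetSpan (X × X) X) : SetSpan ((X × X) × X) X :=
  (μ.prod (id X)).comp μ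

/-- The span `μ ∘ (id ⊗ μ)`, with source rebracketed to `(X × X) × X`. -/
def mulRight {X : Type u} (μ : SetSpan (X × X) X) : SetSpan ((X × X) × X) X :=
  (((id X).prod μ).comp μ).relabel (Equiv.prodAssoc X X X).symm (Equiv.refl X)

/-- The span `μ ∘ (η ⊗ id)`, with source `PUnit × X` identified with `X`. -/
def unitMul {X : Type u} (η : SetSpan PUnit.{u + 1} X) (μ : SetSpan (X × X) X) : SetSpan X X :=
  ((η.prod (id X)).comp μ).relabel (Equiv.punitProd X) (Equiv.refl X)

/-- The span `μ ∘ (id ⊗ η)`, with source `X × PUnit` identified with `X`. -/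
def mulUnit {X : Type u} (η : SetSpan PUnit.{u + 1} X) (μ : SetSpan (X × X) X) : SetSpan X X :=
  (((id X).prod η).comp μ).relabel (Equiv.prodPUnit X) (Equiv.refl X)

/-- For a `2`-isomorphism `a : μ ∘ (μ ⊗ id) ⇒ μ ∘ (id ⊗ μ)`, the relation saying that `a` sends
the pair `(m, m')` (where the output of `m` is the first input of `m'`) to the pair `(p, p')`
(where the output of `p` is the second input of `p'`). -/
def AssocRel {X : Type u} {μ : SetSpan (X × X) X} (a : Iso μ.mulLeft μ.mulRight)
    (m m' p p' : μ.apex) : Prop :=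
  ∃ h : μ.right m = (μ.left m').1,
    (a.toEquiv ⟨((m, (μ.left m').2), m'), Prod.ext h rfl⟩).1.1.2 = p ∧
    (a.toEquiv ⟨((m, (μ.left m').2), m'), Prod.ext h rfl⟩).1.2 = p'

end SetSpan

open SetSpan in
/-- A pseudomonoid in the monoidal bicategory of spans of sets.

Up to the canonical rebracketings, an element of the apex of a composite of multiplications and
units is a consistent family of elements of the apexes of the vertices of the corresponding string
diagram, and a `2`-morphism placed in a part of the diagram changes only the elements of that
part. The two coherence equations are stated on such families. -/
structure SpanPseudomonoid : Type (u + 1) where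
  /-- the underlying set -/
  carrier : Type u
  /-- the unit `η` -/
  unit : SetSpan PUnit.{u + 1} carrier
  /-- the multiplication `μ` -/
  mul : SetSpan (carrier × carrier) carrier
  /-- the associator `a` -/
  assoc : Iso mul.mulLeft mul.mulRight
  /-- the left unitor `ℓ` -/
  leftUnitor : Iso (unitMul unit mul) (SetSpan.id carrier)
  /-- the right unitor `r` -/
  rightUnitor : Iso (mulUnit unit mul) (SetSpan.id carrier)
  /-- The pentagon equation on a family `(m₁, m₂, m₃)` bracketed as `((x₁ x₂) x₃) x₄`. One side is
  `(m₁, m₂, m₃) ↦ (p, p', m₃) ↦ (p, q, q') ↦ (r, r', q')`; the other is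
  `(m₁, m₂, m₃) ↦ (m₁, b, b') ↦ (b, c, c')`, where the second step includes the interchange of
  the vertices `m₁` and `b`, which lie over disjoint strands. -/
  pentagon : ∀ m₁ m₂ m₃ p p' q q' r r' b b' c c' : mul.apex,
    AssocRel assoc m₁ m₂ p p' → AssocRel assoc p' m₃ q q' → AssocRel assoc p q r r' →
    AssocRel assoc m₂ m₃ b b' → AssocRel assoc m₁ b' c c' →
    r = b ∧ r' = c ∧ q' = c'
  /-- The triangle equation on a family `(e, m, m')` with `e` in the apex of the unit, bracketed as
  `(x₁ e) x₂`. Applying `r` to `(m, e)` leaves `m'`; applying `a` to `(m, m')` gives `(p, p')`, and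
  then applying `ℓ` to `(e, p)` leaves `p'`. -/
  triangle : ∀ (e : unit.apex) (m m' p p' : mul.apex), unit.right e = (mul.left m).2 →
    AssocRel assoc m m' p p' → p' = m'

/-! ## Frobenius pseudomonoids in spans -/

namespace SetSpan

/-- The span `(id ⊗ α) ∘ (β ⊗ id)` from `X` to `X`, up to rebracketing and unit
identifications. -/
def snakeZ {X : Type u} (α : SetSpan (X × X) PUnit.{u + 1}) (β : SetSpan PUnit.{u + 1} (X × X)) :
    SetSpan X X :=
  ((β.prod (id X)).relabel (Equiv.punitProd X) (Equiv.prodAssoc X X X)).comp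
    (((id X).prod α).relabel (Equiv.refl _) (Equiv.prodPUnit X))

/-- The span `(α ⊗ id) ∘ (id ⊗ β)` from `X` to `X`, up to rebracketing and unit
identifications. -/
def snakeN {X : Type u} (α : SetSpan (X × X) PUnit.{u + 1}) (β : SetSpan PUnit.{u + 1} (X × X)) :
    SetSpan X X :=
  (((id X).prod β).relabel (Equiv.prodPUnit X) (Equiv.prodAssoc X X X).symm).comp
    ((α.prod (id X)).relabel (Equiv.refl _) (Equiv.punitProd X))

/-- The span `(α ⊗ α) ∘ (id ⊗ β ⊗ id)`, with apex the set of consistent triples `(a, b, a')`. -/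
def pairingZigzag {X : Type u} (α : SetSpan (X × X) PUnit.{u + 1})
    (β : SetSpan PUnit.{u + 1} (X × X)) : SetSpan (X × X) PUnit.{u + 1} where
  apex := {t : α.apex × β.apex × α.apex //
    (α.left t.1).2 = (β.right t.2.1).1 ∧ (β.right t.2.1).2 = (α.left t.2.2).1}
  left t := ((α.left t.1.1).1, (α.left t.1.2.2).2)
  right _ := PUnit.unit

/-- The span `(id ⊗ α ⊗ id) ∘ (β ⊗ β)`, with apex the set of consistent triples `(b, a, b')`. -/
def copairingZigzag {X : Type u} (α : SetSpan (X × X) PUnit.{u + 1})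
    (β : SetSpan PUnit.{u + 1} (X × X)) : SetSpan PUnit.{u + 1} (X × X) where
  apex := {t : β.apex × α.apex × β.apex //
    (β.right t.1).2 = (α.left t.2.1).1 ∧ (α.left t.2.1).2 = (β.right t.2.2).1}
  left _ := PUnit.unit
  right t := ((β.right t.1.1).1, (β.right t.1.2.2).2)

/-- The legs of the first snake agree once it is isomorphic to the identity. -/
theorem snakeZ_legs {X : Type u} {α : SetSpan (X × X) PUnit.{u + 1}}
    {β : SetSpan PUnit.{u + 1} (X × X)} (z : Iso (snakeZ α β) (id X)) (b : β.apex) (a : α.apex)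
    (h : (β.right b).2 = (α.left a).1) : (β.right b).1 = (α.left a).2 :=
  let e : (snakeZ α β).apex :=
    ⟨((b, (α.left a).2), ((β.right b).1, a)), Prod.ext rfl (Prod.ext h rfl)⟩
  (z.right_toEquiv e).symm.trans (z.left_toEquiv e)

/-- The legs of the second snake agree once it is isomorphic to the identity. -/
theorem snakeN_legs {X : Type u} {α : SetSpan (X × X) PUnit.{u + 1}}
    {β : SetSpan PUnit.{u + 1} (X × X)} (n : Iso (snakeN α β) (id X)) (a : α.apex) (b : β.apex)
    (h : (α.left a).2 = (β.right b).1) : (α.left a).1 = (β.right b).2 :=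
  let e : (snakeN α β).apex :=
    ⟨(((α.left a).1, b), (a, (β.right b).2)), Prod.ext (Prod.ext rfl h.symm) rfl⟩
  (n.left_toEquiv e).symm.trans (n.right_toEquiv e)

/-- The `2`-morphism obtained by applying `n` to the part `(a, b)` of `(a, b, a')`. This yields
`(n (a, b), a')` in the apex of `α ∘ (id ⊗ id)`, which the unitor identifies with `a'`. -/
def pairingZigzagN {X : Type u} {α : SetSpan (X × X) PUnit.{u + 1}}
    {β : SetSpan PUnit.{u + 1} (X × X)} (n : Iso (snakeN α β) (id X)) :
    Hom (pairingZigzag α β) α where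
  toFun t := t.1.2.2
  left_toFun t := Prod.ext (((snakeN_legs n _ _ t.2.1).trans t.2.2).symm) rfl
  right_toFun _ := rfl

/-- The `2`-morphism obtained by applying `z` to the part `(b, a')` of `(a, b, a')`. This yields
`(z (b, a'), a)` in the apex of `α ∘ (id ⊗ id)`, which the unitor identifies with `a`. -/
def pairingZigzagZ {X : Type u} {α : SetSpan (X × X) PUnit.{u + 1}}
    {β : SetSpan PUnit.{u + 1} (X × X)} (z : Iso (snakeZ α β) (id X)) :
    Hom (pairingZigzag α β) α where
  toFun t := t.1.1
  left_toFun t := Prod.ext rfl (t.2.1.trans (snakeZ_legs z _ _ t.2.2))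
  right_toFun _ := rfl

/-- The `2`-morphism obtained by applying `n` to the part `(a, b')` of `(b, a, b')`. This yields
`(b, n (a, b'))` in the apex of `(id ⊗ id) ∘ β`, which the unitor identifies with `b`. -/
def copairingZigzagN {X : Type u} {α : SetSpan (X × X) PUnit.{u + 1}}
    {β : SetSpan PUnit.{u + 1} (X × X)} (n : Iso (snakeN α β) (id X)) :
    Hom (copairingZigzag α β) β where
  toFun t := t.1.1
  left_toFun _ := rfl
  right_toFun t := Prod.ext rfl (t.2.1.trans (snakeN_legs n _ _ t.2.2))

/-- The `2`-morphism obtained by applying `z` to the part `(b, a)` of `(b, a, b')`. This yields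
`(b', z (b, a))` in the apex of `(id ⊗ id) ∘ β`, which the unitor identifies with `b'`. -/
def copairingZigzagZ {X : Type u} {α : SetSpan (X × X) PUnit.{u + 1}}
    {β : SetSpan PUnit.{u + 1} (X × X)} (z : Iso (snakeZ α β) (id X)) :
    Hom (copairingZigzag α β) β where
  toFun t := t.1.2.2
  left_toFun _ := rfl
  right_toFun t := Prod.ext (((snakeZ_legs z _ _ t.2.1).trans t.2.2).symm) rfl

/-- A pairing `α` is biexact if there are a copairing `β` and invertible `2`-morphisms `z`, `n`
from the two snakes to the identity satisfying the two coherence equations. -/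
def Biexact {X : Type u} (α : SetSpan (X × X) PUnit.{u + 1}) : Prop :=
  ∃ (β : SetSpan PUnit.{u + 1} (X × X)) (z : Iso (snakeZ α β) (id X))
    (n : Iso (snakeN α β) (id X)),
    pairingZigzagN n = pairingZigzagZ z ∧ copairingZigzagN n = copairingZigzagZ z

end SetSpan

namespace SpanPseudomonoid

/-- A Frobenius structure on a pseudomonoid: a counit `ε` such that the pairing `ε ∘ μ` is
biexact. -/
structure FrobeniusStructure (P : SpanPseudomonoid.{u}) : Type (u + 1) where
  /-- the counit `ε` -/
  counit : SetSpan P.carrier PUnit.{u + 1}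
  biexact : SetSpan.Biexact (P.mul.comp counit)

/-- Two Frobenius structures are equivalent if their counits are `2`-isomorphic. -/
instance FrobeniusStructure.setoid (P : SpanPseudomonoid.{u}) : Setoid (FrobeniusStructure P) where
  r F G := Nonempty (SetSpan.Iso F.counit G.counit)
  iseqv := ⟨fun _ => ⟨SetSpan.Iso.refl _⟩, fun ⟨f⟩ => ⟨f.symm⟩, fun ⟨f⟩ ⟨g⟩ => ⟨f.trans g⟩⟩

end SpanPseudomonoid

/-! ## Triangulations of polygons and `2`-Segal sets -/

/-- Two chords `c`, `d` (with `c.1 < c.2`, `d.1 < d.2`) of the polygon with vertices `0, …, n` in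
cyclic order cross in their interiors. -/
def ChordsCross {n : ℕ} (c d : Fin (n + 1) × Fin (n + 1)) : Prop :=
  (c.1 < d.1 ∧ d.1 < c.2 ∧ c.2 < d.2) ∨ (d.1 < c.1 ∧ c.1 < d.2 ∧ d.2 < c.2)

/-- A triangulation of the convex polygon with vertices `0, …, n`, given by a maximal set of
pairwise noncrossing chords (the sides of the polygon included). -/
structure PolygonTriangulation (n : ℕ) where
  /-- the chords -/
  chords : Set (Fin (n + 1) × Fin (n + 1))
  lt_of_mem : ∀ c ∈ chords, c.1 < c.2
  noncrossing : ∀ c ∈ chords, ∀ d ∈ chords, ¬ ChordsCross c d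
  maximal : ∀ c : Fin (n + 1) × Fin (n + 1), c.1 < c.2 →
    (∀ d ∈ chords, ¬ ChordsCross c d) → c ∈ chords

/-- The triangles of a triangulation, given by their vertices in increasing order. -/
def PolygonTriangulation.Triangle {n : ℕ} (T : PolygonTriangulation n) : Type :=
  {t : Fin 3 ↪o Fin (n + 1) // ∀ i j, i < j → (t i, t j) ∈ T.chords}

namespace SSet

/-- The iterated fibre product `X₂ ×_{X₁} ⋯ ×_{X₁} X₂` attached to a triangulation: the families of
`2`-simplices indexed by the triangles which agree on all edges shared by triangles. -/
def TriangulationLimit (X : SSet.{u}) {n : ℕ} (T : PolygonTriangulation n) : Type u :=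
  {ξ : T.Triangle → X _⦋2⦌ // ∀ (t t' : T.Triangle) (i j : Fin 3),
    (Fin.succAboveOrderEmb i).trans t.1 = (Fin.succAboveOrderEmb j).trans t'.1 →
      X.δ i (ξ t) = X.δ j (ξ t')}

/-- The map `X_n → X₂ ×_{X₁} ⋯ ×_{X₁} X₂` induced by a triangulation. -/
def triangulationMap (X : SSet.{u}) {n : ℕ} (T : PolygonTriangulation n) (ψ : X _⦋n⦌) :
    X.TriangulationLimit T :=
  ⟨fun t => X.map (SimplexCategory.mkHom t.1.toOrderHom).op ψ, by
    intro t t' i j h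
    rw [SimplicialObject.δ_def, SimplicialObject.δ_def, ← Functor.map_comp_apply,
      ← Functor.map_comp_apply, ← op_comp, ← op_comp]
    have h' : SimplexCategory.δ i ≫ SimplexCategory.mkHom t.1.toOrderHom =
        SimplexCategory.δ j ≫ SimplexCategory.mkHom t'.1.toOrderHom := by
      ext k
      exact congrArg Fin.val (DFunLike.congr_fun h k)
    rw [h']⟩

/-- A simplicial set is `2`-Segal if for every triangulation of every `(n + 1)`-gon, `n ≥ 2`, the
induced map is bijective. -/
def IsTwoSegal (X : SSet.{u}) : Prop :=
  ∀ n : ℕ, 2 ≤ n → ∀ T : PolygonTriangulation n, Function.Bijective (X.triangulationMap T)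

end SSet

namespace SSet

/-- The triangulation of the square with diagonal `02`. -/
def squareTriangulation₀₂ : PolygonTriangulation 3 where
  chords := {c | c.1 < c.2 ∧ c ≠ (1, 3)}
  lt_of_mem _ h := h.1
  noncrossing := by
    rintro ⟨a, b⟩ h ⟨c, d⟩ h'
    revert a b c d
    simp only [Set.mem_ofPred_eq, ChordsCross]
    decide
  maximal := by
    rintro ⟨a, b⟩ h h'
    have h1 := h' (0, 2) (by simp)
    clear h'
    revert a b
    simp only [Set.mem_ofPred_eq, ChordsCross]
    decide

/-- The triangulation of the square with diagonal `13`. -/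
def squareTriangulation₁₃ : PolygonTriangulation 3 where
  chords := {c | c.1 < c.2 ∧ c ≠ (0, 2)}
  lt_of_mem _ h := h.1
  noncrossing := by
    rintro ⟨a, b⟩ h ⟨c, d⟩ h'
    revert a b c d
    simp only [Set.mem_ofPred_eq, ChordsCross]
    decide
  maximal := by
    rintro ⟨a, b⟩ h h'
    have h1 := h' (1, 3) (by simp)
    clear h'
    revert a b
    simp only [Set.mem_ofPred_eq, ChordsCross]
    decide

/-- The triangulation of the pentagon with diagonals `02` and `03`. -/
def pentagonTriangulation : PolygonTriangulation 4 where
  chords := {c | c.1 < c.2 ∧ (c.1 = 0 ∨ c.2.val = c.1.val + 1)}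
  lt_of_mem _ h := h.1
  noncrossing := by
    rintro ⟨a, b⟩ h ⟨c, d⟩ h'
    revert a b c d
    simp only [Set.mem_ofPred_eq, ChordsCross]
    decide
  maximal := by
    rintro ⟨a, b⟩ h h'
    have h1 := h' (0, 2) (by simp)
    have h2 := h' (0, 3) (by simp)
    clear h'
    revert a b
    simp only [Set.mem_ofPred_eq, ChordsCross]
    decide

theorem triangle_ext {n : ℕ} {t t' : Fin 3 ↪o Fin (n + 1)} (h0 : t 0 = t' 0) (h1 : t 1 = t' 1)
    (h2 : t 2 = t' 2) : t = t' := by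
  ext k
  fin_cases k
  · exact congrArg Fin.val h0
  · exact congrArg Fin.val h1
  · exact congrArg Fin.val h2

theorem exists_of_triangles {X : SSet.{u}} (hX : X.IsTwoSegal) {n k : ℕ} (hn : 2 ≤ n)
    (T : PolygonTriangulation n) (tri : Fin k → (Fin 3 ↪o Fin (n + 1)))
    (hmem : ∀ p i j, i < j → (tri p i, tri p j) ∈ T.chords)
    (hinj : ∀ p q, tri p 1 = tri q 1 → p = q)
    (hsurj : ∀ a b c, (a, b) ∈ T.chords → (a, c) ∈ T.chords → (b, c) ∈ T.chords →
      ∃ p, tri p 0 = a ∧ tri p 1 = b ∧ tri p 2 = c)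
    (ζ : Fin k → X _⦋2⦌)
    (hζ : ∀ (p q : Fin k) (i j : Fin 3),
      (∀ l, tri p (i.succAbove l) = tri q (j.succAbove l)) → X.δ i (ζ p) = X.δ j (ζ q)) :
    ∃! ψ : X _⦋n⦌, ∀ p, X.map (SimplexCategory.mkHom (tri p).toOrderHom).op ψ = ζ p := by
  let tri' : Fin k → T.Triangle := fun p => ⟨tri p, hmem p⟩
  have htri : Function.Bijective tri' := by
    constructor
    · intro p q hpq
      exact hinj p q (congrArg (fun t : T.Triangle => t.1 1) hpq)
    · rintro ⟨t, ht⟩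
      obtain ⟨p, h0, h1, h2⟩ := hsurj _ _ _ (ht 0 1 (by decide)) (ht 0 2 (by decide))
        (ht 1 2 (by decide))
      exact ⟨p, Subtype.ext (triangle_ext h0 h1 h2)⟩
  let e : Fin k ≃ T.Triangle := Equiv.ofBijective tri' htri
  have he : ∀ p, (e p).1 = tri p := fun _ => rfl
  let ξ : X.TriangulationLimit T := ⟨fun t => ζ (e.symm t), by
    intro t t' i j h
    apply hζ
    intro l
    rw [← he, ← he, Equiv.apply_symm_apply, Equiv.apply_symm_apply]
    exact DFunLike.congr_fun h l⟩
  obtain ⟨ψ, hψ⟩ := (hX n hn T).2 ξ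
  refine ⟨ψ, fun p => ?_, fun ψ' h' => ?_⟩
  · have h1 := congrFun (congrArg Subtype.val hψ) (e p)
    have h2 : ξ.1 (e p) = ζ p := congrArg ζ (e.symm_apply_apply p)
    exact h1.trans h2
  · apply (hX n hn T).1
    rw [hψ]
    apply Subtype.ext
    funext t
    obtain ⟨p, rfl⟩ := e.surjective t
    have h2 : ξ.1 (e p) = ζ p := congrArg ζ (e.symm_apply_apply p)
    exact (h' p).trans h2.symm

theorem square₀₂ {X : SSet.{u}} (hX : X.IsTwoSegal) (ξ ξ' : X _⦋2⦌) (h : X.δ 1 ξ = X.δ 2 ξ') :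
    ∃! ψ : X _⦋3⦌, X.δ 3 ψ = ξ ∧ X.δ 1 ψ = ξ' := by
  have := exists_of_triangles hX (by norm_num) squareTriangulation₀₂
    ![Fin.succAboveOrderEmb 3, Fin.succAboveOrderEmb 1]
    (by change ∀ p i j, i < j → _ < _ ∧ _ ≠ _; decide) (by decide)
    (by
      rintro a b c ⟨h1, h1'⟩ ⟨h2, h2'⟩ ⟨h3, h3'⟩
      simp only [ne_eq, Prod.mk.injEq] at h1 h1' h2 h2' h3 h3'
      revert a b c
      decide)
    ![ξ, ξ'] (by
    intro p q i j
    fin_cases p <;> fin_cases q <;> fin_cases i <;> fin_cases j <;>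
      first
      | exact fun _ => rfl
      | exact fun _ => h
      | exact fun _ => h.symm
      | (intro hl; exfalso; revert hl; change ¬ (∀ l, _); decide))
  obtain ⟨ψ, h1, h2⟩ := this
  exact ⟨ψ, ⟨h1 0, h1 1⟩, fun ψ' h' => h2 ψ' (Fin.forall_fin_two.2 h')⟩

theorem square₁₃ {X : SSet.{u}} (hX : X.IsTwoSegal) (ξ ξ' : X _⦋2⦌) (h : X.δ 1 ξ = X.δ 0 ξ') :
    ∃! ψ : X _⦋3⦌, X.δ 0 ψ = ξ ∧ X.δ 2 ψ = ξ' := by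
  have := exists_of_triangles hX (by norm_num) squareTriangulation₁₃
    ![Fin.succAboveOrderEmb 2, Fin.succAboveOrderEmb 0]
    (by change ∀ p i j, i < j → _ < _ ∧ _ ≠ _; decide) (by decide)
    (by
      rintro a b c ⟨h1, h1'⟩ ⟨h2, h2'⟩ ⟨h3, h3'⟩
      simp only [ne_eq, Prod.mk.injEq] at h1 h1' h2 h2' h3 h3'
      revert a b c
      decide)
    ![ξ', ξ] (by
    intro p q i j
    fin_cases p <;> fin_cases q <;> fin_cases i <;> fin_cases j <;>
      first
      | exact fun _ => rfl
      | exact fun _ => h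
      | exact fun _ => h.symm
      | (intro hl; exfalso; revert hl; change ¬ (∀ l, _); decide))
  obtain ⟨ψ, h1, h2⟩ := this
  exact ⟨ψ, ⟨h1 1, h1 0⟩, fun ψ' h' => h2 ψ' (Fin.forall_fin_two.2 h'.symm)⟩

theorem pentagon_exists {X : SSet.{u}} (hX : X.IsTwoSegal) (ξ₁ ξ₂ ξ₃ : X _⦋2⦌)
    (h : X.δ 1 ξ₁ = X.δ 2 ξ₂) (h' : X.δ 1 ξ₂ = X.δ 2 ξ₃) :
    ∃ ψ : X _⦋4⦌, X.δ 3 (X.δ 4 ψ) = ξ₁ ∧ X.δ 1 (X.δ 4 ψ) = ξ₂ ∧ X.δ 1 (X.δ 2 ψ) = ξ₃ := by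
  have := exists_of_triangles hX (by norm_num) pentagonTriangulation
    ![(Fin.succAboveOrderEmb 3).trans (Fin.succAboveOrderEmb 4),
      (Fin.succAboveOrderEmb 1).trans (Fin.succAboveOrderEmb 4),
      (Fin.succAboveOrderEmb 1).trans (Fin.succAboveOrderEmb 2)]
    (by change ∀ p i j, i < j → _ < _ ∧ (_ ∨ _); decide) (by decide)
    (by
      rintro a b c ⟨h1, h1'⟩ ⟨h2, h2'⟩ ⟨h3, h3'⟩
      simp only at h1 h1' h2 h2' h3 h3'
      revert a b c
      decide)
    ![ξ₁, ξ₂, ξ₃] (by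
    intro p q i j
    fin_cases p <;> fin_cases q <;> fin_cases i <;> fin_cases j <;>
      first
      | exact fun _ => rfl
      | exact fun _ => h
      | exact fun _ => h.symm
      | exact fun _ => h'
      | exact fun _ => h'.symm
      | (intro hl; exfalso; revert hl; change ¬ (∀ l, _); decide))
  obtain ⟨ψ, h1, -⟩ := this
  refine ⟨ψ, ?_, ?_, ?_⟩
  · refine Eq.trans ?_ (h1 0); simp only [SimplicialObject.δ_def, ← Functor.map_comp_apply]; rfl
  · refine Eq.trans ?_ (h1 1); simp only [SimplicialObject.δ_def, ← Functor.map_comp_apply]; rfl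
  · refine Eq.trans ?_ (h1 2); simp only [SimplicialObject.δ_def, ← Functor.map_comp_apply]; rfl

/-- Left unitality of `2`-Segal sets. -/
theorem eq_σ_zero {X : SSet.{u}} (hX : X.IsTwoSegal) (ξ : X _⦋2⦌) (v : X _⦋0⦌)
    (h : X.δ 2 ξ = X.σ 0 v) : ξ = X.σ 0 (X.δ 1 ξ) := by
  have h3 : X.δ 3 (X.σ 0 ξ) = X.δ 3 (X.σ 1 ξ) := by
    have e0 : X.δ 3 (X.σ 0 ξ) = X.σ 0 (X.δ 2 ξ) := X.δ_comp_σ_of_gt_apply (i := 2) (j := 0) (by decide) ξ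
    have e1 : X.δ 3 (X.σ 1 ξ) = X.σ 1 (X.δ 2 ξ) := X.δ_comp_σ_of_gt_apply (i := 2) (j := 1) (by decide) ξ
    rw [e0, e1, h]
    exact X.σ_comp_σ_apply (i := 0) (j := 0) (by decide) v
  have h1 : X.δ 1 (X.σ 0 ξ) = X.δ 1 (X.σ 1 ξ) :=
    (X.δ_comp_σ_succ_apply (0 : Fin 3) ξ).trans (X.δ_comp_σ_self_apply (1 : Fin 3) ξ).symm
  obtain ⟨ψ, -, hu⟩ := square₀₂ hX (X.δ 3 (X.σ 1 ξ)) (X.δ 1 (X.σ 1 ξ))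
    (X.δ_comp_δ_apply (i := 1) (j := 2) (by decide) _)
  have e : X.σ 0 ξ = X.σ 1 ξ := (hu _ ⟨h3, h1⟩).trans (hu _ ⟨rfl, rfl⟩).symm
  have e1 : X.δ 2 (X.σ 1 ξ) = ξ := X.δ_comp_σ_succ_apply (1 : Fin 3) ξ
  rw [← e] at e1
  exact e1.symm.trans (X.δ_comp_σ_of_gt_apply (i := 1) (j := 0) (by decide) ξ)

/-- Right unitality of `2`-Segal sets. -/
theorem eq_σ_one {X : SSet.{u}} (hX : X.IsTwoSegal) (ξ : X _⦋2⦌) (v : X _⦋0⦌)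
    (h : X.δ 0 ξ = X.σ 0 v) : ξ = X.σ 1 (X.δ 1 ξ) := by
  have h0 : X.δ 0 (X.σ 2 ξ) = X.δ 0 (X.σ 1 ξ) := by
    have e0 : X.δ 0 (X.σ 2 ξ) = X.σ 1 (X.δ 0 ξ) := X.δ_comp_σ_of_le_apply (i := 0) (j := 1) (by decide) ξ
    have e1 : X.δ 0 (X.σ 1 ξ) = X.σ 0 (X.δ 0 ξ) := X.δ_comp_σ_of_le_apply (i := 0) (j := 0) (by decide) ξ
    rw [e0, e1, h]
    exact (X.σ_comp_σ_apply (i := 0) (j := 0) (by decide) v).symm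
  have h2 : X.δ 2 (X.σ 2 ξ) = X.δ 2 (X.σ 1 ξ) :=
    (X.δ_comp_σ_self_apply (2 : Fin 3) ξ).trans (X.δ_comp_σ_succ_apply (1 : Fin 3) ξ).symm
  obtain ⟨ψ, -, hu⟩ := square₁₃ hX (X.δ 0 (X.σ 1 ξ)) (X.δ 2 (X.σ 1 ξ))
    (X.δ_comp_δ_apply (i := 0) (j := 1) (by decide) _).symm
  have e : X.σ 2 ξ = X.σ 1 ξ := (hu _ ⟨h0, h2⟩).trans (hu _ ⟨rfl, rfl⟩).symm
  have e1 : X.δ 1 (X.σ 1 ξ) = ξ := X.δ_comp_σ_self_apply (1 : Fin 3) ξ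
  rw [← e] at e1
  exact e1.symm.trans (X.δ_comp_σ_of_le_apply (i := 1) (j := 1) (by decide) ξ)

/-! ## The pseudomonoid of a `2`-Segal set -/

/-- The multiplication span `X₁ × X₁ ← X₂ → X₁` with legs `(d₂, d₀)` and `d₁`. -/
def mulSpan (X : SSet.{u}) : SetSpan (X _⦋1⦌ × X _⦋1⦌) (X _⦋1⦌) where
  apex := X _⦋2⦌
  left ξ := (X.δ 2 ξ, X.δ 0 ξ)
  right ξ := X.δ 1 ξ

/-- The unit span `PUnit ← X₀ → X₁` with right leg `s₀`. -/
def unitSpan (X : SSet.{u}) : SetSpan PUnit.{u + 1} (X _⦋1⦌) where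
  apex := X _⦋0⦌
  left _ := PUnit.unit
  right v := X.σ 0 v

/-- The map `X₃ → X₂ ×_{X₁} X₂`, `ψ ↦ (d₃ ψ, d₁ ψ)`, into the apex of `μ ∘ (μ ⊗ id)`. -/
def toMulLeft (X : SSet.{u}) (ψ : X _⦋3⦌) : X.mulSpan.mulLeft.apex :=
  ⟨((X.δ 3 ψ, X.δ 0 (X.δ 1 ψ)), X.δ 1 ψ),
    Prod.ext (X.δ_comp_δ_apply (i := 1) (j := 2) (by decide) ψ) rfl⟩

/-- The map `X₃ → X₂ ×_{X₁} X₂`, `ψ ↦ (d₂ ψ, d₀ ψ)`, into the apex of `μ ∘ (id ⊗ μ)` (the upper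
vertex `d₀ ψ` is written first). -/
def toMulRight (X : SSet.{u}) (ψ : X _⦋3⦌) : X.mulSpan.mulRight.apex :=
  ⟨((X.δ 2 (X.δ 2 ψ), X.δ 0 ψ), X.δ 2 ψ),
    Prod.ext rfl (X.δ_comp_δ_apply (i := 0) (j := 1) (by decide) ψ).symm⟩

theorem toMulLeft_bijective {X : SSet.{u}} (hX : X.IsTwoSegal) :
    Function.Bijective X.toMulLeft := by
  constructor
  · intro ψ ψ' h
    have h' := congrArg Subtype.val h
    have h3 : X.δ 3 ψ = X.δ 3 ψ' := congrArg (fun q => q.1.1) h'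
    have h1 : X.δ 1 ψ = X.δ 1 ψ' := congrArg (fun q => q.2) h'
    exact (square₀₂ hX _ _ (X.δ_comp_δ_apply (i := 1) (j := 2) (by decide) ψ')).unique
      ⟨h3, h1⟩ ⟨rfl, rfl⟩
  · rintro ⟨⟨⟨m, x⟩, m'⟩, h⟩
    have h0 : X.δ 1 m = X.δ 2 m' := congrArg Prod.fst h
    have hx : x = X.δ 0 m' := congrArg Prod.snd h
    obtain ⟨ψ, ⟨e3, e1⟩, -⟩ := square₀₂ hX m m' h0
    refine ⟨ψ, Subtype.ext (Prod.ext (Prod.ext e3 ?_) e1)⟩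
    exact (congrArg (X.δ 0) e1).trans hx.symm

theorem toMulRight_bijective {X : SSet.{u}} (hX : X.IsTwoSegal) :
    Function.Bijective X.toMulRight := by
  constructor
  · intro ψ ψ' h
    have h' := congrArg Subtype.val h
    have h0 : X.δ 0 ψ = X.δ 0 ψ' := congrArg (fun q => q.1.2) h'
    have h2 : X.δ 2 ψ = X.δ 2 ψ' := congrArg (fun q => q.2) h'
    exact (square₁₃ hX _ _ (X.δ_comp_δ_apply (i := 0) (j := 1) (by decide) ψ').symm).unique
      ⟨h0, h2⟩ ⟨rfl, rfl⟩
  · rintro ⟨⟨⟨x, m⟩, m'⟩, h⟩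
    have h0 : X.δ 1 m = X.δ 0 m' := congrArg Prod.snd h
    have hx : x = X.δ 2 m' := congrArg Prod.fst h
    obtain ⟨ψ, ⟨e0, e2⟩, -⟩ := square₁₃ hX m m' h0
    refine ⟨ψ, Subtype.ext (Prod.ext (Prod.ext ?_ e0) e2)⟩
    exact (congrArg (X.δ 2) e2).trans hx.symm

/-- The associator: the composite of the inverse of `ψ ↦ (d₃ ψ, d₁ ψ)` with
`ψ ↦ (d₂ ψ, d₀ ψ)`. -/
noncomputable def segalAssociator (X : SSet.{u}) (hX : X.IsTwoSegal) :
    SetSpan.Iso X.mulSpan.mulLeft X.mulSpan.mulRight where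
  toEquiv := (Equiv.ofBijective _ (toMulLeft_bijective hX)).symm.trans
    (Equiv.ofBijective _ (toMulRight_bijective hX))
  left_toEquiv s := by
    obtain ⟨ψ, rfl⟩ := (Equiv.ofBijective _ (toMulLeft_bijective hX)).surjective s
    rw [Equiv.trans_apply, Equiv.symm_apply_apply]
    exact Prod.ext (Prod.ext (X.δ_comp_δ_apply (i := 2) (j := 2) (by decide) ψ).symm
      (X.δ_comp_δ_apply (i := 0) (j := 2) (by decide) ψ).symm)
      (X.δ_comp_δ_apply (i := 0) (j := 0) (by decide) ψ).symm
  right_toEquiv s := by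
    obtain ⟨ψ, rfl⟩ := (Equiv.ofBijective _ (toMulLeft_bijective hX)).surjective s
    rw [Equiv.trans_apply, Equiv.symm_apply_apply]
    exact X.δ_comp_δ_apply (i := 1) (j := 1) (by decide) ψ

/-- The left unitor, inverse to `x ↦ (d₁ x, s₀ x)`. -/
def segalLeftUnitor (X : SSet.{u}) (hX : X.IsTwoSegal) :
    SetSpan.Iso (SetSpan.unitMul X.unitSpan X.mulSpan) (SetSpan.id (X _⦋1⦌)) where
  toEquiv :=
    { toFun := fun p => X.δ 1 p.1.2
      invFun := fun x => ⟨((X.δ 1 x, x), X.σ 0 x), Prod.ext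
        (X.δ_comp_σ_of_gt_apply (i := 1) (j := 0) (by decide) x).symm
        (X.δ_comp_σ_self_apply 0 x).symm⟩
      left_inv := by
        rintro ⟨⟨⟨v, x⟩, ξ⟩, h⟩
        have hv : X.σ 0 v = X.δ 2 ξ := congrArg Prod.fst h
        have hx : x = X.δ 0 ξ := congrArg Prod.snd h
        have e : ξ = X.σ 0 (X.δ 1 ξ) := eq_σ_zero hX ξ v hv.symm
        have hx' : x = X.δ 1 ξ := by
          rw [hx]
          exact (congrArg (X.δ 0) e).trans (X.δ_comp_σ_self_apply 0 _)
        have hv' : v = X.δ 1 (X.δ 1 ξ) :=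
          (X.δ_comp_σ_succ_apply 0 v).symm.trans ((congrArg (X.δ 1) hv).trans
            (X.δ_comp_δ_apply (i := 1) (j := 1) (by decide) ξ))
        exact Subtype.ext (Prod.ext (Prod.ext hv'.symm hx'.symm) e.symm)
      right_inv := fun x => X.δ_comp_σ_succ_apply 0 x }
  left_toEquiv := by
    rintro ⟨⟨⟨v, x⟩, ξ⟩, h⟩
    have hv : X.σ 0 v = X.δ 2 ξ := congrArg Prod.fst h
    have hx : x = X.δ 0 ξ := congrArg Prod.snd h
    have e : ξ = X.σ 0 (X.δ 1 ξ) := eq_σ_zero hX ξ v hv.symm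
    have e0 : X.δ 0 (X.σ 0 (X.δ 1 ξ)) = X.δ 1 ξ := X.δ_comp_σ_self_apply (0 : Fin 2) (X.δ 1 ξ)
    rw [← e] at e0
    exact e0.symm.trans hx.symm
  right_toEquiv _ := rfl

/-- The right unitor, inverse to `x ↦ (d₀ x, s₁ x)`. -/
def segalRightUnitor (X : SSet.{u}) (hX : X.IsTwoSegal) :
    SetSpan.Iso (SetSpan.mulUnit X.unitSpan X.mulSpan) (SetSpan.id (X _⦋1⦌)) where
  toEquiv :=
    { toFun := fun p => X.δ 1 p.1.2
      invFun := fun x => ⟨((x, X.δ 0 x), X.σ 1 x), Prod.ext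
        (X.δ_comp_σ_succ_apply 1 x).symm
        (X.δ_comp_σ_of_le_apply (i := 0) (j := 0) (by decide) x).symm⟩
      left_inv := by
        rintro ⟨⟨⟨x, v⟩, ξ⟩, h⟩
        have hx : x = X.δ 2 ξ := congrArg Prod.fst h
        have hv : X.σ 0 v = X.δ 0 ξ := congrArg Prod.snd h
        have e : ξ = X.σ 1 (X.δ 1 ξ) := eq_σ_one hX ξ v hv.symm
        have hx' : x = X.δ 1 ξ := by
          rw [hx]
          exact (congrArg (X.δ 2) e).trans (X.δ_comp_σ_succ_apply 1 _)
        have hv' : v = X.δ 0 (X.δ 1 ξ) :=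
          (X.δ_comp_σ_self_apply 0 v).symm.trans ((congrArg (X.δ 0) hv).trans
            (X.δ_comp_δ_apply (i := 0) (j := 0) (by decide) ξ).symm)
        exact Subtype.ext (Prod.ext (Prod.ext hx'.symm hv'.symm) e.symm)
      right_inv := fun x => X.δ_comp_σ_self_apply (1 : Fin 2) x }
  left_toEquiv := by
    rintro ⟨⟨⟨x, v⟩, ξ⟩, h⟩
    have hx : x = X.δ 2 ξ := congrArg Prod.fst h
    have hv : X.σ 0 v = X.δ 0 ξ := congrArg Prod.snd h
    have e : ξ = X.σ 1 (X.δ 1 ξ) := eq_σ_one hX ξ v hv.symm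
    have e2 : X.δ 2 (X.σ 1 (X.δ 1 ξ)) = X.δ 1 ξ := X.δ_comp_σ_succ_apply (1 : Fin 2) (X.δ 1 ξ)
    rw [← e] at e2
    exact e2.symm.trans hx.symm
  right_toEquiv _ := rfl

theorem assocRel_faces {X : SSet.{u}} (hX : X.IsTwoSegal) {m m' p p' : X _⦋2⦌}
    (h : SetSpan.AssocRel (μ := X.mulSpan) (X.segalAssociator hX) m m' p p') (χ : X _⦋3⦌)
    (h3 : X.δ 3 χ = m) (h1 : X.δ 1 χ = m') : p = X.δ 0 χ ∧ p' = X.δ 2 χ := by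
  obtain ⟨h0, e, e'⟩ := h
  subst h3 h1
  have key : (X.segalAssociator hX).toEquiv (X.toMulLeft χ) = X.toMulRight χ :=
    congrArg X.toMulRight ((Equiv.ofBijective _ (toMulLeft_bijective hX)).symm_apply_apply χ)
  have key' := congrArg Subtype.val key
  exact ⟨e.symm.trans (congrArg (fun q => q.1.2) key'),
    e'.symm.trans (congrArg (fun q => q.2) key')⟩

/-- The pseudomonoid in spans determined by a `2`-Segal set. -/
noncomputable def pseudomonoid (X : SSet.{u}) (hX : X.IsTwoSegal) : SpanPseudomonoid.{u} where
  carrier := X _⦋1⦌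
  unit := X.unitSpan
  mul := X.mulSpan
  assoc := X.segalAssociator hX
  leftUnitor := X.segalLeftUnitor hX
  rightUnitor := X.segalRightUnitor hX
  pentagon := by
    intro m₁ m₂ m₃ p p' q q' r r' b b' c c' h₁ h₂ h₃ h₄ h₅
    obtain ⟨ψ, e₁, e₂, e₃⟩ := pentagon_exists hX m₁ m₂ m₃ (congrArg id h₁.1) (congrArg id h₄.1)
    obtain ⟨hp, hp'⟩ := assocRel_faces hX h₁ (X.δ 4 ψ) e₁ e₂
    obtain ⟨hq, hq'⟩ := assocRel_faces hX h₂ (X.δ 2 ψ)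
      ((X.δ_comp_δ_apply (i := 2) (j := 3) (by decide) ψ).symm.trans hp'.symm) e₃
    obtain ⟨hr, hr'⟩ := assocRel_faces hX h₃ (X.δ 0 ψ)
      ((X.δ_comp_δ_apply (i := 0) (j := 3) (by decide) ψ).symm.trans hp.symm)
      ((X.δ_comp_δ_apply (i := 0) (j := 1) (by decide) ψ).symm.trans hq.symm)
    obtain ⟨hb, hb'⟩ := assocRel_faces hX h₄ (X.δ 1 ψ)
      ((X.δ_comp_δ_apply (i := 1) (j := 3) (by decide) ψ).symm.trans e₂)
      ((X.δ_comp_δ_apply (i := 1) (j := 1) (by decide) ψ).symm.trans e₃)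
    obtain ⟨hc, hc'⟩ := assocRel_faces hX h₅ (X.δ 3 ψ)
      ((X.δ_comp_δ_apply (i := 3) (j := 3) (by decide) ψ).symm.trans e₁)
      ((X.δ_comp_δ_apply (i := 1) (j := 2) (by decide) ψ).trans hb'.symm)
    refine ⟨?_, ?_, ?_⟩
    · rw [hr, hb]; exact X.δ_comp_δ_apply (i := 0) (j := 0) (by decide) ψ |>.symm
    · rw [hr', hc]; exact X.δ_comp_δ_apply (i := 0) (j := 2) (by decide) ψ |>.symm
    · rw [hq', hc']; exact X.δ_comp_δ_apply (i := 2) (j := 2) (by decide) ψ |>.symm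
  triangle := by
    intro e m m' p p' he h
    have hm : m = X.σ 1 (X.δ 1 m) := eq_σ_one hX m e (Eq.symm he)
    have h0 : X.δ 1 m = X.δ 2 m' := h.1
    have h3 : X.δ 3 (X.σ 1 m') = m := by
      refine (X.δ_comp_σ_of_gt_apply (i := 2) (j := 1) (by decide) m').trans ?_
      rw [← h0]
      exact hm.symm
    exact (assocRel_faces hX h (X.σ 1 m') h3 (X.δ_comp_σ_self_apply (1 : Fin 3) m')).2.trans
      (X.δ_comp_σ_succ_apply (1 : Fin 3) m')

/-! ## Paracyclic structures -/

/-- A paracyclic structure on a simplicial set: a `ℤ`-action on each `X_n`, given by the bijection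
`τⁿ` by which the generator acts, compatible with the face and degeneracy maps. -/
@[ext]
structure ParacyclicStructure (X : SSet.{u}) : Type u where
  /-- the bijections `τⁿ` -/
  τ : ∀ n : ℕ, X _⦋n⦌ ≃ X _⦋n⦌
  /-- `dᵢ τⁿ⁺¹ = τⁿ dᵢ₊₁` for `i ≤ n` -/
  δ_τ : ∀ (n : ℕ) (i : Fin (n + 1)) (x : X _⦋n + 1⦌),
    X.δ i.castSucc (τ (n + 1) x) = τ n (X.δ i.succ x)
  /-- `dₙ₊₁ τⁿ⁺¹ = d₀` -/
  δ_last_τ : ∀ (n : ℕ) (x : X _⦋n + 1⦌), X.δ (Fin.last (n + 1)) (τ (n + 1) x) = X.δ 0 x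
  /-- `sᵢ τⁿ = τⁿ⁺¹ sᵢ₊₁` for `i < n` -/
  σ_τ : ∀ (n : ℕ) (i : Fin n) (x : X _⦋n⦌),
    X.σ i.castSucc (τ n x) = τ (n + 1) (X.σ i.succ x)
  /-- `sₙ τⁿ = (τⁿ⁺¹)² s₀` -/
  σ_last_τ : ∀ (n : ℕ) (x : X _⦋n⦌),
    X.σ (Fin.last n) (τ n x) = τ (n + 1) (τ (n + 1) (X.σ 0 x))

/-- A system of extra degeneracy maps `sⁿₙ₊₁ : X_n → X_{n+1}`, satisfying the simplicial relations
with the exception of the one for `d₀ sⁿₙ₊₁`, which is only required to be bijective. -/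
@[ext]
structure ExtraDegeneracies (X : SSet.{u}) : Type u where
  /-- the extra degeneracies -/
  s : ∀ n : ℕ, X _⦋n⦌ → X _⦋n + 1⦌
  /-- `dᵢ sⁿ⁺¹ₙ₊₂ = sⁿₙ₊₁ dᵢ` for `0 < i < n + 2` -/
  δ_s : ∀ (n : ℕ) (i : Fin (n + 1)) (x : X _⦋n + 1⦌),
    X.δ i.succ.castSucc (s (n + 1) x) = s n (X.δ i.succ x)
  /-- `dₙ₊₁ sⁿₙ₊₁ = id` -/
  δ_last_s : ∀ (n : ℕ) (x : X _⦋n⦌), X.δ (Fin.last (n + 1)) (s n x) = x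
  /-- `sᵢ sⁿₙ₊₁ = sⁿ⁺¹ₙ₊₂ sᵢ` for `i ≤ n` -/
  σ_s : ∀ (n : ℕ) (i : Fin (n + 1)) (x : X _⦋n⦌),
    X.σ i.castSucc (s n x) = s (n + 1) (X.σ i x)
  /-- `sₙ₊₁ sⁿₙ₊₁ = sⁿ⁺¹ₙ₊₂ sⁿₙ₊₁`, where `sₙ₊₁` is the last ordinary degeneracy -/
  σ_last_s : ∀ (n : ℕ) (x : X _⦋n⦌), X.σ (Fin.last (n + 1)) (s n x) = s (n + 1) (s n x)
  /-- the maps `d₀ sⁿₙ₊₁` are bijective -/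
  bijective : ∀ n : ℕ, Function.Bijective fun x : X _⦋n⦌ => X.δ 0 (s n x)

/-- The span `X₁ ← X₀ → PUnit` with left leg the extra degeneracy `s⁰₁ = τ¹ s₀`. -/
def ParacyclicStructure.counitSpan {X : SSet.{u}} (P : X.ParacyclicStructure) :
    SetSpan (X _⦋1⦌) PUnit.{u + 1} where
  apex := X _⦋0⦌
  left v := P.τ 1 (X.σ 0 v)
  right _ := PUnit.unit

end SSet

/-! In spans of sets biexactness is a property: a pairing is biexact exactly when both legs of its
apex to `X` are bijections (`SetSpan.biexact_iff`). A counit `ε` is therefore Frobenius if and only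
if each edge is `d₂`, and also `d₀`, of exactly one 2-simplex whose `d₁` is marked by a point of
`ε`. Over degenerate edges, unitality reduces such triangles to degenerate ones, so `d₁` and `d₀`
identify the points of `ε` with vertices. Up to isomorphism `ε` is thus a section `s` of `d₁ : X₁ →
X₀` with unique fillings of both kinds (`exists_isFrobeniusSection_of_biexact`).

By the 2-Segal condition an (n+1)-simplex is its last face glued along the long edge to one
triangle, namely first, next-to-last and last vertex (`existsUnique_glue_last`). Unique filling thus
passes from edges to all simplices: each n-simplex is the last face of exactly one (n+1)-simplex
with long edge in the image of `s` (`IsFrobeniusSection.existsUnique_last`). This filler is the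
extra degeneracy. Its relations follow from uniqueness, because inner faces and degeneracies
preserve long edges, and bijectivity of `d₀` on fillers is the mirror-image statement. Conversely,
extra degeneracies always have long edge in the image of the lowest one, so they are determined by
it.

Paracyclic structures and extra degeneracies correspond formally through `s = τ s₀` and `τ = d₀ s`.
That `τ¹ s₀` is a Frobenius section follows because `τ²` turns the condition on `d₁` into degeneracy
of `d₂`, which unitality solves. -/

namespace SetSpan

/-! ### Biexact pairings in spans of sets -/

variable {X : Type u}

/-- An element of the apex of `snakeZ α β` is a pair `(b, a)` with matching inner legs. -/
def snakeZMk {α : SetSpan (X × X) PUnit.{u + 1}} {β : SetSpan PUnit.{u + 1} (X × X)}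
    (b : β.apex) (a : α.apex) (h : (β.right b).2 = (α.left a).1) : (snakeZ α β).apex :=
  ⟨((b, (α.left a).2), ((β.right b).1, a)), Prod.ext rfl (Prod.ext h rfl)⟩

/-- An element of the apex of `snakeN α β` is a pair `(a, b)` with matching inner legs. -/
def snakeNMk {α : SetSpan (X × X) PUnit.{u + 1}} {β : SetSpan PUnit.{u + 1} (X × X)}
    (a : α.apex) (b : β.apex) (h : (α.left a).2 = (β.right b).1) : (snakeN α β).apex :=
  ⟨(((α.left a).1, b), (a, (β.right b).2)), Prod.ext (Prod.ext rfl h.symm) rfl⟩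

/-- The isomorphism to the identity preserves legs, so the preimage of `x` has both outer legs equal
to `x`. This yields surjectivity of the second leg of `α` and the chains used for injectivity. -/
theorem exists_of_snakeZ_iso {α : SetSpan (X × X) PUnit.{u + 1}}
    {β : SetSpan PUnit.{u + 1} (X × X)} (z : Iso (snakeZ α β) (id X)) (x : X) :
    ∃ b a, (β.right b).2 = (α.left a).1 ∧ (β.right b).1 = x ∧ (α.left a).2 = x := by
  obtain ⟨⟨⟨⟨b, x'⟩, ⟨x'', a⟩⟩, h⟩, hx⟩ := z.toEquiv.surjective x
  have h1 : (β.right b).1 = x'' := congrArg Prod.fst h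
  have h2 : (β.right b).2 = (α.left a).1 := congrArg (fun q => q.2.1) h
  have h3 : x' = (α.left a).2 := congrArg (fun q => q.2.2) h
  have hl : z.toEquiv _ = x' := z.left_toEquiv ⟨((b, x'), (x'', a)), h⟩
  have hr : z.toEquiv _ = x'' := z.right_toEquiv ⟨((b, x'), (x'', a)), h⟩
  exact ⟨b, a, h2, h1.trans (hr.symm.trans hx), h3.symm.trans (hl.symm.trans hx)⟩

theorem exists_of_snakeN_iso {α : SetSpan (X × X) PUnit.{u + 1}}
    {β : SetSpan PUnit.{u + 1} (X × X)} (n : Iso (snakeN α β) (id X)) (x : X) :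
    ∃ a b, (α.left a).2 = (β.right b).1 ∧ (α.left a).1 = x ∧ (β.right b).2 = x := by
  obtain ⟨⟨⟨⟨x', b⟩, ⟨a, x''⟩⟩, h⟩, hx⟩ := n.toEquiv.surjective x
  have h1 : x' = (α.left a).1 := congrArg (fun q => q.1.1) h
  have h2 : (β.right b).1 = (α.left a).2 := congrArg (fun q => q.1.2) h
  have h3 : (β.right b).2 = x'' := congrArg Prod.snd h
  have hl : n.toEquiv _ = x' := n.left_toEquiv ⟨((x', b), (a, x'')), h⟩
  have hr : n.toEquiv _ = x'' := n.right_toEquiv ⟨((x', b), (a, x'')), h⟩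
  exact ⟨a, b, h2.symm, h1.symm.trans (hl.symm.trans hx), h3.trans (hr.symm.trans hx)⟩

/-- The copairing with the same apex as `α` and with its legs exchanged. -/
def flip (α : SetSpan (X × X) PUnit.{u + 1}) : SetSpan PUnit.{u + 1} (X × X) where
  apex := α.apex
  left _ := PUnit.unit
  right a := (α.left a).swap

/-- The first snake of a pairing with bijective second leg and its flip is isomorphic to the
identity. -/
noncomputable def snakeZFlip {α : SetSpan (X × X) PUnit.{u + 1}}
    (h₁ : Function.Injective fun a => (α.left a).1)
    (h₂ : Function.Bijective fun a => (α.left a).2) : Iso (snakeZ α α.flip) (id X) where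
  toEquiv := Equiv.ofBijective (fun p => p.1.1.2) (by
    constructor
    · rintro ⟨⟨⟨b, x⟩, ⟨y, a⟩⟩, h⟩ ⟨⟨⟨b', x'⟩, ⟨y', a'⟩⟩, h'⟩ (e : x = x')
      have e1 : (α.left b).2 = y := congrArg Prod.fst h
      have e2 : b = a := h₁ (congrArg (fun q => q.2.1) h)
      -- Because `β` is the flip of `α`, the inner matching condition compares the first legs of `b`
      -- and `a`; injectivity has just forced `b = a`, so an element of the snake amounts to a
      -- single element of `α`.
      have e3 : x = (α.left a).2 := congrArg (fun q => q.2.2) h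
      have e1' : (α.left b').2 = y' := congrArg Prod.fst h'
      have e2' : b' = a' := h₁ (congrArg (fun q => q.2.1) h')
      have e3' : x' = (α.left a').2 := congrArg (fun q => q.2.2) h'
      subst e2 e2'
      have : b = b' := h₂.1 (e3.symm.trans (e.trans e3'))
      subst this e e1 e1'
      rfl
    · intro x
      obtain ⟨a, ha⟩ := h₂.2 x
      exact ⟨snakeZMk (β := α.flip) a a rfl, ha⟩)
  left_toEquiv _ := rfl
  right_toEquiv := by
    rintro ⟨⟨⟨b, x⟩, ⟨y, a⟩⟩, h⟩
    have e1 : (α.left b).2 = y := congrArg Prod.fst h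
    have e2 : b = a := h₁ (congrArg (fun q => q.2.1) h)
    have e3 : x = (α.left a).2 := congrArg (fun q => q.2.2) h
    subst e2
    exact e3.trans e1

/-- The second snake of a pairing with bijective first leg and its flip is isomorphic to the
identity. -/
noncomputable def snakeNFlip {α : SetSpan (X × X) PUnit.{u + 1}}
    (h₁ : Function.Bijective fun a => (α.left a).1)
    (h₂ : Function.Injective fun a => (α.left a).2) : Iso (snakeN α α.flip) (id X) where
  toEquiv := Equiv.ofBijective (fun p => p.1.1.1) (by
    constructor
    · rintro ⟨⟨⟨x, b⟩, ⟨a, y⟩⟩, h⟩ ⟨⟨⟨x', b'⟩, ⟨a', y'⟩⟩, h'⟩ (e : x = x')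
      have e1 : (α.left b).1 = y := congrArg Prod.snd h
      have e2 : b = a := h₂ (congrArg (fun q => q.1.2) h)
      have e3 : x = (α.left a).1 := congrArg (fun q => q.1.1) h
      have e1' : (α.left b').1 = y' := congrArg Prod.snd h'
      have e2' : b' = a' := h₂ (congrArg (fun q => q.1.2) h')
      have e3' : x' = (α.left a').1 := congrArg (fun q => q.1.1) h'
      subst e2 e2'
      have : b = b' := h₁.1 (e3.symm.trans (e.trans e3'))
      subst this e e1 e1'
      rfl
    · intro x
      obtain ⟨a, ha⟩ := h₁.2 x
      exact ⟨snakeNMk (β := α.flip) a a rfl, ha⟩)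
  left_toEquiv _ := rfl
  right_toEquiv := by
    rintro ⟨⟨⟨x, b⟩, ⟨a, y⟩⟩, h⟩
    have e1 : (α.left b).1 = y := congrArg Prod.snd h
    have e2 : b = a := h₂ (congrArg (fun q => q.1.2) h)
    have e3 : x = (α.left a).1 := congrArg (fun q => q.1.1) h
    subst e2
    exact e3.trans e1

/-- A pairing in spans of sets is biexact if and only if both of its legs are bijective. -/
theorem biexact_iff {α : SetSpan (X × X) PUnit.{u + 1}} :
    Biexact α ↔ Function.Bijective (fun a => (α.left a).1) ∧
      Function.Bijective (fun a => (α.left a).2) := by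
  constructor
  · rintro ⟨β, z, n, hα, -⟩
    -- On a chain `(a, b, a')`, applying `n` keeps `a'` and applying `z` keeps `a`, so coherence
    -- identifies the two ends.
    have key : ∀ (a : α.apex) (b : β.apex) (a' : α.apex), (α.left a).2 = (β.right b).1 →
        (β.right b).2 = (α.left a').1 → a = a' := fun a b a' h h' =>
      (congrArg (fun f => f.toFun ⟨(a, b, a'), h, h'⟩) hα).symm
    refine ⟨⟨fun a a' h => ?_, fun x => ?_⟩, ⟨fun a a' h => ?_, fun x => ?_⟩⟩
    -- Both `a` and `a'` complete the same initial segment `(c, b)` to a chain, hence both equal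
    -- `c`.
    · obtain ⟨c, b, h1, h2, h3⟩ := exists_of_snakeN_iso n (α.left a).1
      exact (key c b a h1 h3).symm.trans (key c b a' h1 (h3.trans h))
    · obtain ⟨a, b, -, h, -⟩ := exists_of_snakeN_iso n x
      exact ⟨a, h⟩
    · obtain ⟨b, c, h1, h2, h3⟩ := exists_of_snakeZ_iso z (α.left a).2
      exact (key a b c h2.symm h1).trans (key a' b c (h.symm.trans h2.symm) h1).symm
    · obtain ⟨b, a, -, -, h⟩ := exists_of_snakeZ_iso z x
      exact ⟨a, h⟩
  · rintro ⟨h₁, h₂⟩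
    -- With the flip as copairing, neighbours in a zigzag share a leg and so coincide; both
    -- coherence equations then compare equal entries.
    refine ⟨α.flip, snakeZFlip h₁.1 h₂, snakeNFlip h₁ h₂.1, ?_, ?_⟩
    · refine Hom.ext (funext ?_)
      rintro ⟨⟨a, b, a'⟩, h, h'⟩
      have e1 : a = b := h₂.1 h
      have e2 : b = a' := h₁.1 h'
      exact (e1.trans e2).symm
    · refine Hom.ext (funext ?_)
      rintro ⟨⟨b, a, b'⟩, h, h'⟩
      have e1 : b = a := h₁.1 h
      have e2 : a = b' := h₂.1 h'
      exact e1.trans e2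

end SetSpan

/-! ### Paracyclic structures and extra degeneracies -/

namespace SSet

variable {X : SSet.{u}}

theorem ParacyclicStructure.δ_zero_τ_σ_zero (P : X.ParacyclicStructure) (n : ℕ) (x : X _⦋n⦌) :
    X.δ 0 (P.τ (n + 1) (X.σ 0 x)) = P.τ n x :=
  (P.δ_τ n 0 _).trans (congrArg (P.τ n) (X.δ_comp_σ_succ_apply 0 x))

/-- The system of extra degeneracies `τⁿ⁺¹ s₀` of a paracyclic structure. -/
def ParacyclicStructure.toExtraDegeneracies (P : X.ParacyclicStructure) :
    X.ExtraDegeneracies where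
  s n x := P.τ (n + 1) (X.σ 0 x)
  δ_s n i x := by
    rw [P.δ_τ]
    exact congrArg (P.τ (n + 1))
      (X.δ_comp_σ_of_gt_apply (i := i.succ) (j := 0) (Fin.succ_pos i) x)
  δ_last_s n x := (P.δ_last_τ n _).trans (X.δ_comp_σ_self_apply 0 x)
  σ_s n i x := by
    rw [P.σ_τ]
    exact congrArg (P.τ (n + 2)) (X.σ_comp_σ_apply (Fin.zero_le i) x).symm
  σ_last_s n x := by
    rw [P.σ_last_τ]
    -- Moving `s₀` past `τ` turns it into `s₁`, and `s₁ s₀ = s₀ s₀` matches the two sides.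
    have h : X.σ 0 (P.τ (n + 1) (X.σ 0 x)) = P.τ (n + 2) (X.σ 1 (X.σ 0 x)) :=
      P.σ_τ (n + 1) 0 (X.σ 0 x)
    rw [h]
    exact congrArg (fun y => P.τ (n + 2) (P.τ (n + 2) y))
      (X.σ_comp_σ_apply (le_refl (0 : Fin (n + 1))) x)
  bijective n := by
    have h : (fun x : X _⦋n⦌ => X.δ 0 (P.τ (n + 1) (X.σ 0 x))) = P.τ n :=
      funext (P.δ_zero_τ_σ_zero n)
    rw [h]
    exact (P.τ n).bijective

/-- The paracyclic structure `d₀ sⁿₙ₊₁` of a system of extra degeneracies. -/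
noncomputable def ExtraDegeneracies.toParacyclicStructure (E : X.ExtraDegeneracies) :
    X.ParacyclicStructure where
  τ n := Equiv.ofBijective _ (E.bijective n)
  δ_τ n i x := by
    change X.δ i.castSucc (X.δ 0 (E.s (n + 1) x)) = X.δ 0 (E.s n (X.δ i.succ x))
    rw [← E.δ_s n i x]
    exact (X.δ_comp_δ_apply (Fin.zero_le i.castSucc) _).symm
  δ_last_τ n x := by
    change X.δ (Fin.last (n + 1)) (X.δ 0 (E.s (n + 1) x)) = X.δ 0 x
    refine (X.δ_comp_δ_apply (Fin.zero_le (Fin.last (n + 1))) _).symm.trans ?_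
    exact congrArg (X.δ 0) (E.δ_last_s (n + 1) x)
  σ_τ n i x := by
    change X.σ i.castSucc (X.δ 0 (E.s n x)) = X.δ 0 (E.s (n + 1) (X.σ i.succ x))
    rw [← E.σ_s n i.succ x]
    exact (X.δ_comp_σ_of_le_apply (i := 0) (Fin.zero_le i.castSucc.castSucc) _).symm
  σ_last_τ n x := by
    change X.σ (Fin.last n) (X.δ 0 (E.s n x)) =
      X.δ 0 (E.s (n + 1) (X.δ 0 (E.s (n + 1) (X.σ 0 x))))
    -- This is `τ s₀ = s`: the extra degeneracy commutes with `s₀`, which `d₀` cancels. So `τ² s₀`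
    -- becomes `d₀ s s`.
    have h : X.δ 0 (E.s (n + 1) (X.σ 0 x)) = E.s n x := by
      rw [← E.σ_s n 0 x]
      exact X.δ_comp_σ_self_apply 0 _
    rw [h, ← E.σ_last_s n x]
    exact (X.δ_comp_σ_of_le_apply (i := 0) (Fin.zero_le (Fin.last n).castSucc) _).symm

/-- Paracyclic structures are the same as systems of extra degeneracies. -/
noncomputable def paracyclicEquivExtraDegeneracies :
    X.ParacyclicStructure ≃ X.ExtraDegeneracies where
  toFun P := P.toExtraDegeneracies
  invFun E := E.toParacyclicStructure
  left_inv P := by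
    apply ParacyclicStructure.ext
    funext n
    apply Equiv.ext
    exact P.δ_zero_τ_σ_zero n
  right_inv E := by
    apply ExtraDegeneracies.ext
    funext n x
    change X.δ 0 (E.s (n + 1) (X.σ 0 x)) = E.s n x
    rw [← E.σ_s n 0 x]
    exact X.δ_comp_σ_self_apply 0 _

end SSet

/-! ### Fan triangulations and their gluing property -/

namespace SSet

/-- The triangle with vertices `a < b < c`. -/
def triangleEmb {n : ℕ} (a b c : Fin n) (hab : a < b) (hbc : b < c) : Fin 3 ↪o Fin n :=
  OrderEmbedding.ofStrictMono ![a, b, c] (by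
    rw [Fin.strictMono_iff_lt_succ]
    exact Fin.forall_fin_two.2 ⟨hab, hbc⟩)

/-- The triangle `0, p + 1, p + 2`. -/
def fanZeroTriangle {m : ℕ} (p : Fin m) : Fin 3 ↪o Fin (m + 2) :=
  triangleEmb 0 p.castSucc.succ p.succ.succ (Fin.succ_pos _)
    (Fin.succ_lt_succ_iff.2 Fin.castSucc_lt_succ)

/-- The triangle `p, p + 1, m + 1`. -/
def fanLastTriangle {m : ℕ} (p : Fin m) : Fin 3 ↪o Fin (m + 2) :=
  triangleEmb p.castSucc.castSucc p.succ.castSucc (Fin.last (m + 1))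
    (Fin.castSucc_lt_castSucc_iff.2 Fin.castSucc_lt_succ) (Fin.castSucc_lt_last _)

/-- The triangulation with all diagonals through the vertex `0`. -/
def fanZero (m : ℕ) : PolygonTriangulation (m + 1) where
  chords := {c | c.1 < c.2 ∧ (c.1 = 0 ∨ c.2.val = c.1.val + 1)}
  lt_of_mem _ h := h.1
  noncrossing := by
    rintro ⟨a, b⟩ ⟨h1, h2⟩ ⟨c, d⟩ ⟨h3, h4⟩ h
    simp only [ChordsCross, Fin.lt_def, Fin.ext_iff, Fin.val_zero] at *
    omega
  maximal := by
    rintro ⟨a, b⟩ h h'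
    refine ⟨h, ?_⟩
    by_contra hc
    simp only [Fin.lt_def, Fin.ext_iff, Fin.val_zero] at h hc
    -- A chord with `0 < a` and `a + 1 < b` is crossed by the diagonal from `0` to `a + 1`.
    have hlt : a.val + 1 < m + 2 := by omega
    refine h' (0, ⟨a.val + 1, hlt⟩) ⟨?_, Or.inl rfl⟩ (Or.inr ?_) <;>
      simp only [Fin.lt_def, Fin.val_zero] <;> omega

/-- The triangulation with all diagonals through the last vertex. -/
def fanLast (m : ℕ) : PolygonTriangulation (m + 1) where
  chords := {c | c.1 < c.2 ∧ (c.2 = Fin.last (m + 1) ∨ c.2.val = c.1.val + 1)}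
  lt_of_mem _ h := h.1
  noncrossing := by
    rintro ⟨a, b⟩ ⟨h1, h2⟩ ⟨c, d⟩ ⟨h3, h4⟩ h
    simp only [ChordsCross, Fin.lt_def, Fin.ext_iff, Fin.val_last] at *
    omega
  maximal := by
    rintro ⟨a, b⟩ h h'
    refine ⟨h, ?_⟩
    by_contra hc
    simp only [Fin.lt_def, Fin.ext_iff, Fin.val_last] at h hc
    -- A chord with `a + 1 < b` and `b` not last is crossed by the diagonal from `a + 1` to the last
    -- vertex.
    have hlt : a.val + 1 < m + 2 := by omega
    refine h' (⟨a.val + 1, hlt⟩, Fin.last (m + 1)) ⟨?_, Or.inl rfl⟩ (Or.inl ?_) <;>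
      simp only [Fin.lt_def, Fin.val_last] <;> omega

variable {X : SSet.{u}}

/-- The restriction of a simplex to a triangle. -/
def restrict {n : ℕ} (t : Fin 3 ↪o Fin (n + 1)) (ψ : X _⦋n⦌) : X _⦋2⦌ :=
  X.map (SimplexCategory.mkHom t.toOrderHom).op ψ

/-- The edge joining the first to the last vertex of a simplex. -/
def longEdge {n : ℕ} (ψ : X _⦋n⦌) : X _⦋1⦌ := X.map (SimplexCategory.diag n).op ψ

/-- Only consecutive triangles of a fan share an edge, namely the diagonal `{0, p + 2}`, which is
face 1 of triangle `p` and face 2 of the next. So compatibility needs checking only there. -/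
theorem existsUnique_fanZero (hX : X.IsTwoSegal) {m : ℕ} (hm : 1 ≤ m) (ζ : Fin m → X _⦋2⦌)
    (hζ : ∀ p q : Fin m, q.val = p.val + 1 → X.δ 1 (ζ p) = X.δ 2 (ζ q)) :
    ∃! ψ : X _⦋m + 1⦌, ∀ p, restrict (fanZeroTriangle p) ψ = ζ p := by
  have val0 : ∀ p : Fin m, (fanZeroTriangle p 0).val = 0 := fun _ => rfl
  have val1 : ∀ p : Fin m, (fanZeroTriangle p 1).val = p.val + 1 := fun _ => rfl
  have val2 : ∀ p : Fin m, (fanZeroTriangle p 2).val = p.val + 2 := fun _ => rfl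
  refine exists_of_triangles hX (by omega) (fanZero m) fanZeroTriangle ?_ ?_ ?_ ζ ?_
  · intro p i j hij
    have lt := (fanZeroTriangle p).strictMono hij
    fin_cases i <;> fin_cases j <;>
      first
      | exact absurd hij (by decide)
      | exact ⟨lt, Or.inl rfl⟩
      | exact ⟨lt, Or.inr rfl⟩
  · intro p q h
    have := congrArg Fin.val h
    rw [val1, val1] at this
    omega
  · rintro a b c ⟨h1, h1'⟩ ⟨h2, h2'⟩ ⟨h3, h3'⟩
    simp only [Fin.lt_def, Fin.ext_iff, Fin.val_zero] at h1 h1' h2 h2' h3 h3'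
    -- Triangle `p` has middle vertex `p + 1`. As `(a, c)` skips `b`, it must be a diagonal, so `a =
    -- 0`, and then `c = b + 1`.
    refine ⟨⟨b.val - 1, by omega⟩, ?_, ?_, ?_⟩ <;> rw [Fin.ext_iff] <;>
      simp only [val0, val1, val2] <;> omega
  · intro p q i j h
    have h0 := congrArg Fin.val (h 0)
    have h1 := congrArg Fin.val (h 1)
    have e : i = j ∧ p = q ∨ i = 1 ∧ j = 2 ∧ q.val = p.val + 1 ∨
        i = 2 ∧ j = 1 ∧ p.val = q.val + 1 := by
      clear h hζ
      fin_cases i <;> fin_cases j <;> revert h0 h1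
      · change p.val + 1 = q.val + 1 → p.val + 2 = q.val + 2 → _
        omega
      · change p.val + 1 = 0 → p.val + 2 = q.val + 2 → _
        omega
      · change p.val + 1 = 0 → p.val + 2 = q.val + 1 → _
        omega
      · change 0 = q.val + 1 → p.val + 2 = q.val + 2 → _
        omega
      · change 0 = 0 → p.val + 2 = q.val + 2 → _
        omega
      · change 0 = 0 → p.val + 2 = q.val + 1 → (_ ∨ 1 = 1 ∧ 2 = 2 ∧ _ ∨ _)
        omega
      · change 0 = q.val + 1 → p.val + 1 = q.val + 2 → _
        omega
      · change 0 = 0 → p.val + 1 = q.val + 2 → (_ ∨ _ ∨ 2 = 2 ∧ 1 = 1 ∧ _)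
        omega
      · change 0 = 0 → p.val + 1 = q.val + 1 → _
        omega
    obtain ⟨rfl, rfl⟩ | ⟨rfl, rfl, e⟩ | ⟨rfl, rfl, e⟩ := e
    · rfl
    · exact hζ p q e
    · exact (hζ q p e).symm

theorem existsUnique_fanLast (hX : X.IsTwoSegal) {m : ℕ} (hm : 1 ≤ m) (ζ : Fin m → X _⦋2⦌)
    (hζ : ∀ p q : Fin m, q.val = p.val + 1 → X.δ 0 (ζ p) = X.δ 1 (ζ q)) :
    ∃! ψ : X _⦋m + 1⦌, ∀ p, restrict (fanLastTriangle p) ψ = ζ p := by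
  have val0 : ∀ p : Fin m, (fanLastTriangle p 0).val = p.val := fun _ => rfl
  have val1 : ∀ p : Fin m, (fanLastTriangle p 1).val = p.val + 1 := fun _ => rfl
  have val2 : ∀ p : Fin m, (fanLastTriangle p 2).val = m + 1 := fun _ => rfl
  refine exists_of_triangles hX (by omega) (fanLast m) fanLastTriangle ?_ ?_ ?_ ζ ?_
  · intro p i j hij
    have lt := (fanLastTriangle p).strictMono hij
    fin_cases i <;> fin_cases j <;>
      first
      | exact absurd hij (by decide)
      | exact ⟨lt, Or.inl rfl⟩
      | exact ⟨lt, Or.inr rfl⟩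
  · intro p q h
    have := congrArg Fin.val h
    rw [val1, val1] at this
    omega
  · rintro a b c ⟨h1, h1'⟩ ⟨h2, h2'⟩ ⟨h3, h3'⟩
    simp only [Fin.lt_def, Fin.ext_iff, Fin.val_last] at h1 h1' h2 h2' h3 h3'
    refine ⟨⟨a.val, by omega⟩, ?_, ?_, ?_⟩ <;> rw [Fin.ext_iff] <;>
      simp only [val0, val1, val2] <;> omega
  · intro p q i j h
    have h0 := congrArg Fin.val (h 0)
    have h1 := congrArg Fin.val (h 1)
    have e : i = j ∧ p = q ∨ i = 0 ∧ j = 1 ∧ q.val = p.val + 1 ∨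
        i = 1 ∧ j = 0 ∧ p.val = q.val + 1 := by
      have hp := p.isLt
      have hq := q.isLt
      clear h hζ
      fin_cases i <;> fin_cases j <;> revert h0 h1
      · change p.val + 1 = q.val + 1 → m + 1 = m + 1 → _
        omega
      · change p.val + 1 = q.val → m + 1 = m + 1 → (_ ∨ 0 = 0 ∧ 1 = 1 ∧ _ ∨ _)
        omega
      · change p.val + 1 = q.val → m + 1 = q.val + 1 → _
        omega
      · change p.val = q.val + 1 → m + 1 = m + 1 → (_ ∨ _ ∨ 1 = 1 ∧ 0 = 0 ∧ _)
        omega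
      · change p.val = q.val → m + 1 = m + 1 → _
        omega
      · change p.val = q.val → m + 1 = q.val + 1 → _
        omega
      · change p.val = q.val + 1 → p.val + 1 = m + 1 → _
        omega
      · change p.val = q.val → p.val + 1 = m + 1 → _
        omega
      · change p.val = q.val → p.val + 1 = q.val + 1 → _
        omega
    obtain ⟨rfl, rfl⟩ | ⟨rfl, rfl, e⟩ | ⟨rfl, rfl, e⟩ := e
    · rfl
    · exact hζ p q e
    · exact (hζ q p e).symm

/-! ### Restriction to triangles and long edges -/

theorem map_map_eq {k m m' n : ℕ} {f : ⦋k⦌ ⟶ ⦋m⦌} {g : ⦋m⦌ ⟶ ⦋n⦌} {f' : ⦋k⦌ ⟶ ⦋m'⦌}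
    {g' : ⦋m'⦌ ⟶ ⦋n⦌} (h : ∀ i, g (f i) = g' (f' i)) (ψ : X _⦋n⦌) :
    X.map f.op (X.map g.op ψ) = X.map f'.op (X.map g'.op ψ) := by
  rw [← Functor.map_comp_apply, ← Functor.map_comp_apply, ← op_comp, ← op_comp]
  have h' : f ≫ g = f' ≫ g' := by
    ext i
    exact congrArg Fin.val (h i)
  rw [h']

theorem map_map_eq_map {k m n : ℕ} {f : ⦋k⦌ ⟶ ⦋m⦌} {g : ⦋m⦌ ⟶ ⦋n⦌} {f' : ⦋k⦌ ⟶ ⦋n⦌}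
    (h : ∀ i, g (f i) = f' i) (ψ : X _⦋n⦌) :
    X.map f.op (X.map g.op ψ) = X.map f'.op ψ := by
  rw [← Functor.map_comp_apply, ← op_comp]
  have h' : f ≫ g = f' := by
    ext i
    exact congrArg Fin.val (h i)
  rw [h']

theorem restrict_δ {n : ℕ} {i : Fin (n + 2)} {t : Fin 3 ↪o Fin (n + 1)}
    {t' : Fin 3 ↪o Fin (n + 2)} (h : ∀ k, i.succAbove (t k) = t' k) (ψ : X _⦋n + 1⦌) :
    restrict t (X.δ i ψ) = restrict t' ψ :=
  map_map_eq_map h ψ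

theorem δ_restrict_eq {n : ℕ} {i j : Fin 3} {t t' : Fin 3 ↪o Fin (n + 1)}
    (h0 : t (i.succAbove 0) = t' (j.succAbove 0)) (h1 : t (i.succAbove 1) = t' (j.succAbove 1))
    (ψ : X _⦋n⦌) : X.δ i (restrict t ψ) = X.δ j (restrict t' ψ) :=
  map_map_eq (Fin.forall_fin_two.2 ⟨h0, h1⟩) ψ

theorem δ_restrict_eq_longEdge {n : ℕ} {i : Fin 3} {t : Fin 3 ↪o Fin (n + 1)}
    (h0 : t (i.succAbove 0) = 0) (h1 : t (i.succAbove 1) = Fin.last n)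
    (ψ : X _⦋n⦌) : X.δ i (restrict t ψ) = longEdge ψ :=
  map_map_eq_map (Fin.forall_fin_two.2 ⟨h0, h1⟩) ψ

theorem δ_restrict_eq_longEdge_δ {n : ℕ} {i : Fin 3} {j : Fin (n + 2)}
    {t : Fin 3 ↪o Fin (n + 2)} (h0 : t (i.succAbove 0) = j.succAbove 0)
    (h1 : t (i.succAbove 1) = j.succAbove (Fin.last n)) (ψ : X _⦋n + 1⦌) :
    X.δ i (restrict t ψ) = longEdge (X.δ j ψ) :=
  map_map_eq (Fin.forall_fin_two.2 ⟨h0, h1⟩) ψ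

@[simp]
theorem longEdge_one (x : X _⦋1⦌) : longEdge x = x := by
  have h : SimplexCategory.diag 1 = 𝟙 _ := by
    ext i
    fin_cases i <;> rfl
  rw [longEdge, h, op_id, Functor.map_id_apply]

/-- The index `i.castSucc.succ` runs over `1, …, n`, so the face omits an inner vertex and keeps
both endpoints. -/
theorem longEdge_δ {n : ℕ} (i : Fin n) (ψ : X _⦋n + 1⦌) :
    longEdge (X.δ i.castSucc.succ ψ) = longEdge ψ :=
  map_map_eq_map (Fin.forall_fin_two.2 ⟨by
    change Fin.succAbove i.castSucc.succ 0 = 0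
    simp, by
    change Fin.succAbove i.castSucc.succ (Fin.last n) = Fin.last (n + 1)
    rw [Fin.succAbove_of_le_castSucc, Fin.succ_last]
    rw [Fin.succ_castSucc]
    exact Fin.castSucc_le_castSucc_iff.2 (Fin.le_last _)⟩) ψ

theorem longEdge_σ {n : ℕ} (i : Fin (n + 1)) (ψ : X _⦋n⦌) :
    longEdge (X.σ i ψ) = longEdge ψ :=
  map_map_eq_map (Fin.forall_fin_two.2 ⟨by
    change Fin.predAbove i 0 = 0
    simp, by
    change Fin.predAbove i (Fin.last (n + 1)) = Fin.last n
    simp⟩) ψ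

/-! ### Gluing a triangle to a simplex along its long edge -/

/-- A simplex of a `2`-Segal set amounts to its last face together with the triangle joining the
last edge of the simplex to its first vertex. -/
theorem existsUnique_glue_last (hX : X.IsTwoSegal) {n : ℕ} (x : X _⦋n + 1⦌) (ξ : X _⦋2⦌)
    (h : X.δ 2 ξ = longEdge x) :
    ∃! ψ : X _⦋n + 2⦌, X.δ (Fin.last (n + 2)) ψ = x ∧
      restrict (fanZeroTriangle (Fin.last n)) ψ = ξ := by
  have hface : ∀ (ψ : X _⦋n + 2⦌) (p : Fin n), restrict (fanZeroTriangle p)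
      (X.δ (Fin.last (n + 2)) ψ) = restrict (fanZeroTriangle p.castSucc) ψ := by
    intro ψ p
    refine restrict_δ (fun k => ?_) ψ
    rw [Fin.succAbove_last]
    fin_cases k <;> rfl
  have hfan : ∀ p q : Fin n, q.val = p.val + 1 → X.δ 1 (restrict (fanZeroTriangle p) x) =
      X.δ 2 (restrict (fanZeroTriangle q) x) := fun p q hpq =>
    δ_restrict_eq (i := 1) (j := 2) (t := fanZeroTriangle p) (t' := fanZeroTriangle q) rfl
      (Fin.ext (show p.val + 2 = q.val + 1 by omega)) x
  -- The fan of `ψ` at `0` has to be the fan of `x` followed by `ξ`; they meet along the long edge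
  -- of `x`.
  let ζ : Fin (n + 1) → X _⦋2⦌ :=
    Fin.snoc (α := fun _ => X _⦋2⦌) (fun p => restrict (fanZeroTriangle p) x) ξ
  have hζl : ζ (Fin.last n) = ξ := Fin.snoc_last ..
  have hζc : ∀ p : Fin n, ζ p.castSucc = restrict (fanZeroTriangle p) x :=
    fun p => Fin.snoc_castSucc (α := fun _ => X _⦋2⦌) ..
  obtain ⟨ψ, hψ, hu⟩ := existsUnique_fanZero hX (by omega) ζ (by
    intro p q hpq
    obtain ⟨p, rfl⟩ : ∃ p' : Fin n, p'.castSucc = p :=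
      ⟨⟨p.val, by omega⟩, rfl⟩
    rw [hζc]
    induction q using Fin.lastCases with
    | last =>
      rw [hζl, h]
      exact δ_restrict_eq_longEdge rfl
        (Fin.ext (show p.val + 2 = n + 1 by simp at hpq; omega)) x
    | cast q =>
      rw [hζc]
      exact hfan p q hpq)
  have hψl : restrict (fanZeroTriangle (Fin.last n)) ψ = ξ := (hψ _).trans hζl
  refine ⟨ψ, ⟨?_, hψl⟩, ?_⟩
  -- For `n = 0` the simplex `x` is an edge with an empty fan, so it is compared through its long
  -- edge instead.
  · rcases Nat.eq_zero_or_pos n with rfl | hn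
    · rw [← longEdge_one (X.δ (Fin.last (0 + 2)) ψ), ← longEdge_one x, ← h, ← hψl]
      exact (δ_restrict_eq_longEdge_δ rfl rfl ψ).symm
    · refine (existsUnique_fanZero hX hn _ hfan).unique (fun p => ?_) (fun p => rfl)
      rw [hface, hψ, hζc]
  · rintro ψ' ⟨h1, h2⟩
    refine hu ψ' (fun p => ?_)
    induction p using Fin.lastCases with
    | last => rw [h2, hζl]
    | cast p => rw [hζc, ← h1, hface]

/-- A simplex of a `2`-Segal set amounts to its zeroth face together with the triangle joining the
first edge of the simplex to its last vertex. -/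
theorem existsUnique_glue_zero (hX : X.IsTwoSegal) {n : ℕ} (x : X _⦋n + 1⦌) (ξ : X _⦋2⦌)
    (h : X.δ 0 ξ = longEdge x) :
    ∃! ψ : X _⦋n + 2⦌, X.δ 0 ψ = x ∧
      restrict (fanLastTriangle (0 : Fin (n + 1))) ψ = ξ := by
  have hface : ∀ (ψ : X _⦋n + 2⦌) (p : Fin n), restrict (fanLastTriangle p)
      (X.δ 0 ψ) = restrict (fanLastTriangle p.succ) ψ := by
    intro ψ p
    refine restrict_δ (fun k => ?_) ψ
    rw [Fin.succAbove_zero]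
    fin_cases k <;> rfl
  have hfan : ∀ p q : Fin n, q.val = p.val + 1 → X.δ 0 (restrict (fanLastTriangle p) x) =
      X.δ 1 (restrict (fanLastTriangle q) x) := fun p q hpq =>
    δ_restrict_eq (i := 0) (j := 1) (t := fanLastTriangle p) (t' := fanLastTriangle q)
      (Fin.ext (show p.val + 1 = q.val by omega)) rfl x
  let ζ : Fin (n + 1) → X _⦋2⦌ :=
    Fin.cons (α := fun _ => X _⦋2⦌) ξ (fun p => restrict (fanLastTriangle p) x)
  have hζ0 : ζ 0 = ξ := rfl
  have hζs : ∀ p : Fin n, ζ p.succ = restrict (fanLastTriangle p) x := fun p => rfl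
  obtain ⟨ψ, hψ, hu⟩ := existsUnique_fanLast hX (by omega) ζ (by
    intro p q hpq
    obtain ⟨q, rfl⟩ : ∃ q' : Fin n, q'.succ = q :=
      ⟨⟨q.val - 1, by omega⟩, Fin.ext (show q.val - 1 + 1 = q.val by omega)⟩
    rw [hζs]
    induction p using Fin.cases with
    | zero =>
      rw [hζ0, h]
      exact (δ_restrict_eq_longEdge
        (Fin.ext (show q.val = 0 by simp at hpq; omega)) rfl x).symm
    | succ p =>
      rw [hζs]
      exact hfan p q (by simp at hpq; omega))
  have hψ0 : restrict (fanLastTriangle 0) ψ = ξ := (hψ _).trans hζ0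
  refine ⟨ψ, ⟨?_, hψ0⟩, ?_⟩
  · rcases Nat.eq_zero_or_pos n with rfl | hn
    · rw [← longEdge_one (X.δ 0 ψ), ← longEdge_one x, ← h, ← hψ0]
      exact (δ_restrict_eq_longEdge_δ rfl rfl ψ).symm
    · refine (existsUnique_fanLast hX hn _ hfan).unique (fun p => ?_) (fun p => rfl)
      rw [hface, hψ, hζs]
  · rintro ψ' ⟨h1, h2⟩
    refine hu ψ' (fun p => ?_)
    induction p using Fin.cases with
    | zero => rw [h2, hζ0]
    | succ p => rw [hζs, ← h1, hface]

/-! ### Frobenius sections and their higher fillers -/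

/-- A section `s` of `d₁ : X₁ → X₀` with the property that `X₁ ← X₀ → PUnit`, with left leg `s`, is
the counit of a Frobenius structure. -/
structure IsFrobeniusSection (s : X _⦋0⦌ → X _⦋1⦌) : Prop where
  δ_one : ∀ v, X.δ 1 (s v) = v
  bijective_δ_zero : Function.Bijective fun v => X.δ 0 (s v)
  fill_last : ∀ x : X _⦋1⦌, ∃! ξ : X _⦋2⦌, X.δ 2 ξ = x ∧ X.δ 1 ξ ∈ Set.range s
  fill_zero : ∀ x : X _⦋1⦌, ∃! ξ : X _⦋2⦌, X.δ 0 ξ = x ∧ X.δ 1 ξ ∈ Set.range s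

namespace IsFrobeniusSection

variable {s : X _⦋0⦌ → X _⦋1⦌}

theorem injective (hs : IsFrobeniusSection s) : Function.Injective s :=
  Function.LeftInverse.injective (g := X.δ 1) hs.δ_one

/-- In positive degree `ψ` is `x` with one triangle glued on, whose face 2 is the long edge of `x`
and whose face 1 is the long edge of `ψ`. Filling `x` is thus filling its long edge, which is
`fill_last`. On vertices the filler is `s x`. -/
theorem existsUnique_last (hX : X.IsTwoSegal) (hs : IsFrobeniusSection s) {n : ℕ}
    (x : X _⦋n⦌) :
    ∃! ψ : X _⦋n + 1⦌, X.δ (Fin.last (n + 1)) ψ = x ∧ longEdge ψ ∈ Set.range s := by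
  cases n with
  | zero =>
    refine ⟨s x, ⟨hs.δ_one x, x, (longEdge_one _).symm⟩, ?_⟩
    rintro ψ ⟨h, v, hv⟩
    rw [longEdge_one] at hv
    subst hv
    exact congrArg s ((hs.δ_one v).symm.trans h)
  | succ n =>
    have h2 : ∀ ψ : X _⦋n + 2⦌, X.δ 2 (restrict (fanZeroTriangle (Fin.last n)) ψ) =
        longEdge (X.δ (Fin.last (n + 2)) ψ) := fun ψ =>
      δ_restrict_eq_longEdge_δ (by rw [Fin.succAbove_last]; rfl)
        (by rw [Fin.succAbove_last]; rfl) ψ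
    have h1 : ∀ ψ : X _⦋n + 2⦌, X.δ 1 (restrict (fanZeroTriangle (Fin.last n)) ψ) =
        longEdge ψ := fun ψ => δ_restrict_eq_longEdge rfl rfl ψ
    obtain ⟨ξ, ⟨hξ, hξ'⟩, hu⟩ := hs.fill_last (longEdge x)
    obtain ⟨ψ, ⟨hψ, hψ'⟩, hu'⟩ := existsUnique_glue_last hX x ξ hξ
    refine ⟨ψ, ⟨hψ, ?_⟩, ?_⟩
    · rwa [← h1, hψ']
    · rintro φ ⟨hφ, hφ'⟩
      refine hu' φ ⟨hφ, hu _ ⟨?_, ?_⟩⟩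
      · rw [h2, hφ]
      · rwa [h1]

theorem existsUnique_zero (hX : X.IsTwoSegal) (hs : IsFrobeniusSection s) {n : ℕ}
    (x : X _⦋n⦌) :
    ∃! ψ : X _⦋n + 1⦌, X.δ 0 ψ = x ∧ longEdge ψ ∈ Set.range s := by
  cases n with
  | zero =>
    obtain ⟨v, hv, hu⟩ := hs.bijective_δ_zero.existsUnique x
    refine ⟨s v, ⟨hv, v, (longEdge_one _).symm⟩, ?_⟩
    rintro ψ ⟨h, w, hw⟩
    rw [longEdge_one] at hw
    subst hw
    exact congrArg s (hu w h)
  | succ n =>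
    have h0 : ∀ ψ : X _⦋n + 2⦌, X.δ 0 (restrict (fanLastTriangle (0 : Fin (n + 1))) ψ) =
        longEdge (X.δ 0 ψ) := fun ψ => δ_restrict_eq_longEdge_δ rfl rfl ψ
    have h1 : ∀ ψ : X _⦋n + 2⦌, X.δ 1 (restrict (fanLastTriangle (0 : Fin (n + 1))) ψ) =
        longEdge ψ := fun ψ => δ_restrict_eq_longEdge rfl rfl ψ
    obtain ⟨ξ, ⟨hξ, hξ'⟩, hu⟩ := hs.fill_zero (longEdge x)
    obtain ⟨ψ, ⟨hψ, hψ'⟩, hu'⟩ := existsUnique_glue_zero hX x ξ hξ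
    refine ⟨ψ, ⟨hψ, ?_⟩, ?_⟩
    · rwa [← h1, hψ']
    · rintro φ ⟨hφ, hφ'⟩
      refine hu' φ ⟨hφ, hu _ ⟨?_, ?_⟩⟩
      · rw [h0, hφ]
      · rwa [h1]

/-- The unique filler of a simplex as the last face whose long edge is in the image of `s`. -/
noncomputable def filler (hX : X.IsTwoSegal) (hs : IsFrobeniusSection s) {n : ℕ}
    (x : X _⦋n⦌) : X _⦋n + 1⦌ :=
  (hs.existsUnique_last hX x).choose

theorem δ_last_filler (hX : X.IsTwoSegal) (hs : IsFrobeniusSection s) {n : ℕ} (x : X _⦋n⦌) :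
    X.δ (Fin.last (n + 1)) (hs.filler hX x) = x :=
  (hs.existsUnique_last hX x).choose_spec.1.1

theorem longEdge_filler (hX : X.IsTwoSegal) (hs : IsFrobeniusSection s) {n : ℕ} (x : X _⦋n⦌) :
    longEdge (hs.filler hX x) ∈ Set.range s :=
  (hs.existsUnique_last hX x).choose_spec.1.2

theorem eq_filler (hX : X.IsTwoSegal) (hs : IsFrobeniusSection s) {n : ℕ} {x : X _⦋n⦌}
    {ψ : X _⦋n + 1⦌} (h : X.δ (Fin.last (n + 1)) ψ = x) (h' : longEdge ψ ∈ Set.range s) :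
    ψ = hs.filler hX x :=
  (hs.existsUnique_last hX x).choose_spec.2 ψ ⟨h, h'⟩

/-- The system of extra degeneracies extending a Frobenius section. -/
noncomputable def extraDegeneracies (hX : X.IsTwoSegal) (hs : IsFrobeniusSection s) :
    X.ExtraDegeneracies where
  s _ x := hs.filler hX x
  δ_s n i x := by
    -- Each relation holds because its left side has the last face and the kind of long edge that
    -- characterize the filler on the right.
    refine hs.eq_filler hX ?_ ?_
    · refine (X.δ_comp_δ_apply (Fin.le_last i.succ) _).symm.trans ?_
      exact congrArg (X.δ i.succ) (hs.δ_last_filler hX x)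
    · rw [← Fin.succ_castSucc, longEdge_δ]
      exact hs.longEdge_filler hX x
  δ_last_s _ x := hs.δ_last_filler hX x
  σ_s n i x := by
    refine hs.eq_filler hX ?_ ?_
    · refine (X.δ_comp_σ_of_gt_apply (Fin.castSucc_lt_last i) _).trans ?_
      exact congrArg (X.σ i) (hs.δ_last_filler hX x)
    · rw [longEdge_σ]
      exact hs.longEdge_filler hX x
  σ_last_s n x := by
    refine hs.eq_filler hX (X.δ_comp_σ_succ_apply (Fin.last (n + 1)) _) ?_
    rw [longEdge_σ]
    exact hs.longEdge_filler hX x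
  bijective n := by
    -- Both `d₀` and the last face are bijections to `X_n` from the (n+1)-simplices with long edge
    -- in the range of `s`; the map is the first composed with the inverse of the second.
    constructor
    · intro x y h
      have e : hs.filler hX x = hs.filler hX y := (hs.existsUnique_zero hX _).unique
        ⟨h, hs.longEdge_filler hX x⟩ ⟨rfl, hs.longEdge_filler hX y⟩
      rw [← hs.δ_last_filler hX x, e, hs.δ_last_filler hX y]
    · intro x
      obtain ⟨ψ, ⟨h, h'⟩, -⟩ := hs.existsUnique_zero hX x
      refine ⟨X.δ (Fin.last (n + 1)) ψ, ?_⟩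
      change X.δ 0 (hs.filler hX _) = x
      rw [← hs.eq_filler hX rfl h', h]

theorem extraDegeneracies_s_zero (hX : X.IsTwoSegal) (hs : IsFrobeniusSection s) (v : X _⦋0⦌) :
    (hs.extraDegeneracies hX).s 0 v = s v :=
  (hs.eq_filler hX (hs.δ_one v) ⟨v, (longEdge_one _).symm⟩).symm

end IsFrobeniusSection

/-- Omitting the inner vertex `1` keeps the long edge and lowers the degree of the extra degeneracy,
down to `s⁰₁`. -/
theorem ExtraDegeneracies.longEdge_s (E : X.ExtraDegeneracies) {n : ℕ} (x : X _⦋n⦌) :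
    longEdge (E.s n x) ∈ Set.range (E.s 0) := by
  induction n with
  | zero => exact ⟨x, (longEdge_one _).symm⟩
  | succ n ih =>
    rw [← longEdge_δ 0, Fin.succ_castSucc, E.δ_s]
    exact ih _

/-- A system of extra degeneracies on a `2`-Segal set is determined by its value on vertices. -/
theorem ExtraDegeneracies.ext_of_s_zero (hX : X.IsTwoSegal) {E E' : X.ExtraDegeneracies}
    (hE : IsFrobeniusSection (E.s 0)) (h : E.s 0 = E'.s 0) : E = E' := by
  apply ExtraDegeneracies.ext
  funext n x
  exact (hE.existsUnique_last hX x).unique ⟨E.δ_last_s n x, E.longEdge_s x⟩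
    ⟨E'.δ_last_s n x, h ▸ E'.longEdge_s x⟩

/-! ### From paracyclic structures to Frobenius structures -/

/-- The left leg of the counit span of a paracyclic structure is a Frobenius section. -/
theorem ParacyclicStructure.isFrobeniusSection (hX : X.IsTwoSegal) (P : X.ParacyclicStructure) :
    IsFrobeniusSection fun v => P.τ 1 (X.σ 0 v) := by
  have key : ∀ y : X _⦋1⦌, X.δ 2 (P.τ 2 (X.σ 0 y)) = y ∧ X.δ 0 (P.τ 2 (X.σ 0 y)) = P.τ 1 y ∧
      X.δ 1 (P.τ 2 (X.σ 0 y)) = P.τ 1 (X.σ 0 (X.δ 1 y)) := by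
    intro y
    refine ⟨P.toExtraDegeneracies.δ_last_s 1 y, P.δ_zero_τ_σ_zero 1 y,
      P.toExtraDegeneracies.δ_s 0 0 y⟩
  -- Write `ξ = τ² ζ`. Since `d₁ τ² = τ¹ d₂`, the condition says that `d₂ ζ` is degenerate, and left
  -- unitality gives `ζ = s₀ d₁ ζ`.
  have key' : ∀ ξ : X _⦋2⦌, X.δ 1 ξ ∈ Set.range (fun v => P.τ 1 (X.σ 0 v)) →
      ∃ y, ξ = P.τ 2 (X.σ 0 y) := by
    rintro ξ ⟨v, hv⟩
    obtain ⟨ζ, rfl⟩ := (P.τ 2).surjective ξ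
    have h : X.δ 1 (P.τ 2 ζ) = P.τ 1 (X.δ 2 ζ) := P.δ_τ 1 1 ζ
    have h2 : X.δ 2 ζ = X.σ 0 v := (P.τ 1).injective (h.symm.trans hv.symm)
    exact ⟨X.δ 1 ζ, congrArg _ (eq_σ_zero hX ζ v h2)⟩
  -- The relevant triangles are exactly the `τ² s₀ y`, with `d₂` equal to `y` and `d₀` equal to `τ¹
  -- y`; both are bijective in `y`.
  refine ⟨P.toExtraDegeneracies.δ_last_s 0, P.toExtraDegeneracies.bijective 0, ?_, ?_⟩
  · intro x
    refine ⟨P.τ 2 (X.σ 0 x), ⟨(key x).1, X.δ 1 x, (key x).2.2.symm⟩, ?_⟩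
    rintro ξ ⟨rfl, h⟩
    obtain ⟨y, rfl⟩ := key' ξ h
    rw [(key y).1]
  · intro x
    obtain ⟨x, rfl⟩ := (P.τ 1).surjective x
    refine ⟨P.τ 2 (X.σ 0 x), ⟨(key x).2.1, X.δ 1 x, (key x).2.2.symm⟩, ?_⟩
    rintro ξ ⟨h0, h⟩
    obtain ⟨y, rfl⟩ := key' ξ h
    rw [(P.τ 1).injective ((key y).2.1.symm.trans h0)]

/-- The pairing of a Frobenius section is biexact. -/
theorem IsFrobeniusSection.biexact {s : X _⦋0⦌ → X _⦋1⦌} (hs : IsFrobeniusSection s) :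
    SetSpan.Biexact (X.mulSpan.comp ⟨X _⦋0⦌, s, fun _ => PUnit.unit⟩) := by
  rw [SetSpan.biexact_iff]
  refine ⟨⟨?_, fun x => ?_⟩, ⟨?_, fun x => ?_⟩⟩
  · rintro ⟨⟨ξ, v⟩, h⟩ ⟨⟨ξ', v'⟩, h'⟩ (e : X.δ 2 ξ = X.δ 2 ξ')
    have eξ : ξ = ξ' := (hs.fill_last _).unique ⟨e, v, h.symm⟩ ⟨rfl, v', h'.symm⟩
    subst eξ
    have ev : v = v' := hs.injective (h.symm.trans h')
    subst ev
    rfl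
  · obtain ⟨ξ, ⟨h, v, hv⟩, -⟩ := hs.fill_last x
    exact ⟨⟨(ξ, v), hv.symm⟩, h⟩
  · rintro ⟨⟨ξ, v⟩, h⟩ ⟨⟨ξ', v'⟩, h'⟩ (e : X.δ 0 ξ = X.δ 0 ξ')
    have eξ : ξ = ξ' := (hs.fill_zero _).unique ⟨e, v, h.symm⟩ ⟨rfl, v', h'.symm⟩
    subst eξ
    have ev : v = v' := hs.injective (h.symm.trans h')
    subst ev
    rfl
  · obtain ⟨ξ, ⟨h, v, hv⟩, -⟩ := hs.fill_zero x
    exact ⟨⟨(ξ, v), hv.symm⟩, h⟩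

/-! ### From biexact counits to Frobenius sections -/

section Counit

variable {ε : SetSpan (X _⦋1⦌) PUnit.{u + 1}}

/-- By left unitality, the pairing elements with first leg `s₀ v` are the pairs `(s₀ ε(t), t)` with
`d₁ ε(t) = v`. Bijectivity of the first leg over degenerate edges is therefore the claim. -/
theorem bijective_δ_one_of_biexact (hX : X.IsTwoSegal)
    (hε : SetSpan.Biexact (X.mulSpan.comp ε)) :
    Function.Bijective fun t => X.δ 1 (ε.left t) := by
  obtain ⟨h, -⟩ := SetSpan.biexact_iff.1 hε
  have hδ : ∀ x : X _⦋1⦌, X.δ 2 (X.σ 0 x) = X.σ 0 (X.δ 1 x) := fun x =>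
    X.δ_comp_σ_of_gt_apply (i := 1) (j := 0) (by decide) x
  have hδ' : ∀ x : X _⦋1⦌, X.δ 1 (X.σ 0 x) = x := fun x => X.δ_comp_σ_succ_apply 0 x
  constructor
  · intro t t' e
    have := h.1 (a₁ := ⟨(X.σ 0 (ε.left t), t), hδ' _⟩) (a₂ := ⟨(X.σ 0 (ε.left t'), t'), hδ' _⟩)
      ((hδ _).trans ((congrArg (X.σ 0) e).trans (hδ _).symm))
    exact congrArg (fun q => q.1.2) this
  · intro v
    obtain ⟨⟨⟨ξ, t⟩, ht⟩, hv⟩ := h.2 (X.σ 0 v)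
    have e : ξ = X.σ 0 (ε.left t) := (eq_σ_zero hX ξ v hv).trans (congrArg (X.σ 0) ht)
    have e' : X.σ 0 (X.δ 1 (ε.left t)) = X.σ 0 v :=
      (hδ _).symm.trans ((congrArg (X.δ 2) e.symm).trans hv)
    refine ⟨t, ?_⟩
    have := congrArg (X.δ 0) e'
    rwa [show X.δ 0 (X.σ 0 (X.δ 1 (ε.left t))) = _ from X.δ_comp_σ_self_apply 0 _,
      show X.δ 0 (X.σ 0 v) = v from X.δ_comp_σ_self_apply 0 v] at this

/-- The mirror argument, with the second leg, `s₁` and right unitality. -/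
theorem bijective_δ_zero_of_biexact (hX : X.IsTwoSegal)
    (hε : SetSpan.Biexact (X.mulSpan.comp ε)) :
    Function.Bijective fun t => X.δ 0 (ε.left t) := by
  obtain ⟨-, h⟩ := SetSpan.biexact_iff.1 hε
  have hδ : ∀ x : X _⦋1⦌, X.δ 0 (X.σ 1 x) = X.σ 0 (X.δ 0 x) := fun x =>
    X.δ_comp_σ_of_le_apply (i := 0) (j := 0) (by decide) x
  have hδ' : ∀ x : X _⦋1⦌, X.δ 1 (X.σ 1 x) = x := fun x => X.δ_comp_σ_self_apply (1 : Fin 2) x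
  constructor
  · intro t t' e
    have := h.1 (a₁ := ⟨(X.σ 1 (ε.left t), t), hδ' _⟩) (a₂ := ⟨(X.σ 1 (ε.left t'), t'), hδ' _⟩)
      ((hδ _).trans ((congrArg (X.σ 0) e).trans (hδ _).symm))
    exact congrArg (fun q => q.1.2) this
  · intro v
    obtain ⟨⟨⟨ξ, t⟩, ht⟩, hv⟩ := h.2 (X.σ 0 v)
    have e : ξ = X.σ 1 (ε.left t) := (eq_σ_one hX ξ v hv).trans (congrArg (X.σ 1) ht)
    have e' : X.σ 0 (X.δ 0 (ε.left t)) = X.σ 0 v :=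
      (hδ _).symm.trans ((congrArg (X.δ 0) e.symm).trans hv)
    refine ⟨t, ?_⟩
    have := congrArg (X.δ 0) e'
    rwa [show X.δ 0 (X.σ 0 (X.δ 0 (ε.left t))) = _ from X.δ_comp_σ_self_apply 0 _,
      show X.δ 0 (X.σ 0 v) = v from X.δ_comp_σ_self_apply 0 v] at this

/-- The counit of a Frobenius structure, reparametrized by the vertices of `X`, is a Frobenius
section. -/
theorem exists_isFrobeniusSection_of_biexact (hX : X.IsTwoSegal)
    (hε : SetSpan.Biexact (X.mulSpan.comp ε)) :
    ∃ (s : X _⦋0⦌ → X _⦋1⦌) (e : X _⦋0⦌ ≃ ε.apex), IsFrobeniusSection s ∧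
      ∀ v, ε.left (e v) = s v := by
  -- Indexing the points of `ε` by the inverse of `d₁ ε` makes the left leg a section of `d₁`.
  let e := (Equiv.ofBijective _ (bijective_δ_one_of_biexact hX hε)).symm
  refine ⟨fun v => ε.left (e v), e, ?_, fun _ => rfl⟩
  have hrange : ∀ t, ε.left t ∈ Set.range fun v => ε.left (e v) := fun t =>
    ⟨e.symm t, congrArg ε.left (e.apply_symm_apply t)⟩
  obtain ⟨h₁, h₂⟩ := SetSpan.biexact_iff.1 hε
  refine ⟨e.symm_apply_apply, (bijective_δ_zero_of_biexact hX hε).comp e.bijective, ?_, ?_⟩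
  · intro x
    obtain ⟨⟨⟨ξ, t⟩, ht⟩, hx⟩ := h₁.2 x
    refine ⟨ξ, ⟨hx, (show X.δ 1 ξ = ε.left t from ht) ▸ hrange t⟩, ?_⟩
    rintro ξ' ⟨hx', v, hv⟩
    have := h₁.1 (a₁ := ⟨(ξ', e v), hv.symm⟩) (a₂ := ⟨(ξ, t), ht⟩) (hx'.trans hx.symm)
    exact congrArg (fun q => q.1.1) this
  · intro x
    obtain ⟨⟨⟨ξ, t⟩, ht⟩, hx⟩ := h₂.2 x
    refine ⟨ξ, ⟨hx, (show X.δ 1 ξ = ε.left t from ht) ▸ hrange t⟩, ?_⟩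
    rintro ξ' ⟨hx', v, hv⟩
    have := h₂.1 (a₁ := ⟨(ξ', e v), hv.symm⟩) (a₂ := ⟨(ξ, t), ht⟩) (hx'.trans hx.symm)
    exact congrArg (fun q => q.1.1) this

end Counit

/-! ### The classification -/

/-- The Frobenius structure whose counit is the counit span of a paracyclic structure. -/
def ParacyclicStructure.frobeniusStructure (hX : X.IsTwoSegal) (P : X.ParacyclicStructure) :
    SpanPseudomonoid.FrobeniusStructure (X.pseudomonoid hX) where
  counit := P.counitSpan
  biexact := (P.isFrobeniusSection hX).biexact

/-- Both left legs are sections of `d₁`, so an isomorphism of the counit spans fixes every vertex.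
The lowest extra degeneracies then agree, and they determine the rest. -/
theorem ParacyclicStructure.eq_of_counitSpan_iso (hX : X.IsTwoSegal)
    {P P' : X.ParacyclicStructure} (f : SetSpan.Iso P.counitSpan P'.counitSpan) : P = P' := by
  apply paracyclicEquivExtraDegeneracies.injective
  refine ExtraDegeneracies.ext_of_s_zero hX (P.isFrobeniusSection hX) (funext fun v => ?_)
  have h : P'.τ 1 (X.σ 0 (f.toEquiv v)) = P.τ 1 (X.σ 0 v) := f.left_toEquiv v
  have e : f.toEquiv v = v := ((P'.isFrobeniusSection hX).δ_one _).symm.trans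
    ((congrArg (X.δ 1) h).trans ((P.isFrobeniusSection hX).δ_one v))
  rw [e] at h
  exact h.symm

theorem bijective_mk_frobeniusStructure (hX : X.IsTwoSegal) :
    Function.Bijective fun P : X.ParacyclicStructure =>
      (Quotient.mk _ (P.frobeniusStructure hX) :
        Quotient (SpanPseudomonoid.FrobeniusStructure.setoid (X.pseudomonoid hX))) := by
  constructor
  · intro P P' h
    obtain ⟨f⟩ := Quotient.exact h
    exact ParacyclicStructure.eq_of_counitSpan_iso hX f
  · intro q
    obtain ⟨F, rfl⟩ := Quotient.exists_rep q
    obtain ⟨s, e, hs, he⟩ := exists_isFrobeniusSection_of_biexact hX F.biexact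
    let P := paracyclicEquivExtraDegeneracies.symm (hs.extraDegeneracies hX)
    -- The counit built from the extended section has left leg `s` again, so the reparametrization
    -- `e` is the required 2-isomorphism.
    have hP : ∀ v, P.τ 1 (X.σ 0 v) = s v := fun v => by
      rw [← hs.extraDegeneracies_s_zero hX v]
      exact congrArg (fun E : X.ExtraDegeneracies => E.s 0 v)
        (paracyclicEquivExtraDegeneracies.apply_symm_apply (hs.extraDegeneracies hX))
    exact ⟨P, Quotient.sound
      ⟨⟨e, fun v => (he v).trans (hP v).symm, fun _ => rfl⟩⟩⟩

end SSet
theorem theorem4 (X : SSet.{u}) (hX : X.IsTwoSegal) :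
    (∃ Φ : X.ParacyclicStructure ≃
        Quotient (SpanPseudomonoid.FrobeniusStructure.setoid (X.pseudomonoid hX)),
      ∀ P : X.ParacyclicStructure,
        ∃ F : SpanPseudomonoid.FrobeniusStructure (X.pseudomonoid hX),
          F.counit = P.counitSpan ∧ Φ P = Quotient.mk _ F) ∧
    (∃ Ψ : X.ParacyclicStructure ≃ X.ExtraDegeneracies,
      (∀ (P : X.ParacyclicStructure) (n : ℕ) (x : X _⦋n⦌),
        (Ψ P).s n x = P.τ (n + 1) (X.σ 0 x)) ∧
      (∀ (E : X.ExtraDegeneracies) (n : ℕ) (x : X _⦋n⦌),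
        (Ψ.symm E).τ n x = X.δ 0 (E.s n x))) :=
  ⟨⟨Equiv.ofBijective _ (SSet.bijective_mk_frobeniusStructure hX),
    fun P => ⟨P.frobeniusStructure hX, rfl, rfl⟩⟩,
   ⟨SSet.paracyclicEquivExtraDegeneracies, fun _ _ _ => rfl, fun _ _ _ => rfl⟩⟩
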